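/- **Setting.** All spaces are nonzero finite-dimensional complex Euclidean spaces. Let $r\ge 1$, let $\mathcal X_1,\dots,\mathcal X_r$ (input) and $\mathcal Y_1,\dots,\mathcal Y_r$ (output) be fixed, and put $\mathcal X_{r+1}=\mathcal Z_0=\mathbb C$. An *$r$-round pure strategy* $\tilde A$ with final memory space $\mathcal Z_r$ consists of intermediate memory spaces $\mathcal Z_1,\dots,\mathcal Z_{r-1}$ and linear isometries $A_i:\mathcal X_i\otimes\mathcal Z_{i-1}\to\mathcal Y_i\otimes\mathcal Z_i$ $(1\le i\le r)$. Composing the $A_i$ gives one isometry $\tilde A:\mathcal X_1\otimes\cdots\otimes\mathcal X_r\to\mathcal Y_1\otimes\cdots\otimes\mathcal Y_r\otimes\mathcal Z_r$. The *strategy* $A$ obtained from $\tilde A$ is the channel $X\mapsto \mathrm{Tr}_{\mathcal Z_r}(\tilde A X\tilde A^*)$ (given by its Choi–Jamiołkowski operator), and $\tilde A$ is called a *purification* of $A$. An *$r$-round pure co-strategy* $\tilde B$ with final memory space $\mathcal W_r$ consists of memory spaces $\mathcal W_0,\dots,\mathcal W_{r-1}$, a unit vector $|\beta\rangle\in\mathcal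 X_1\otimes\mathcal W_0$ and linear isometries $B_i:\mathcal Y_i\otimes\mathcal W_{i-1}\to\mathcal X_{i+1}\otimes\mathcal W_i$ $(1\le i\le r)$. Composing $|\beta\rangle$ and the $B_i$ gives one isometry $\tilde B:\mathcal Y_1\otimes\cdots\otimes\mathcal Y_r\to\mathcal X_1\otimes\cdots\otimes\mathcal X_r\otimes\mathcal W_r$. The *co-strategy* $B$ obtained from $\tilde B$ is the channel $Y\mapsto\mathrm{Tr}_{\mathcal W_r}(\tilde BY\tilde B^*)$ (given by the Choi–Jamiołkowski operator of its adjoint), and $\tilde B$ is a purification of $B$. The final state of the interaction is $$|\psi(\tilde A,\tilde B)\rangle=(I_{\mathcal Z_r}\otimes B_r)(A_r\otimes I_{\mathcal W_{r-1}})\cdots(I_{\mathcal Z_1}\otimes B_1)(A_1\otimes I_{\mathcal W_0})|\beta\rangle\in\mathcal Z_r\otimes\mathcal W_r .$$ Its reduced state $\rho_A(\tilde B)=\mathrm{Tr}_{\mathcal Z_r}|\psi(\tilde A,\tilde B)\rangle\langle\psi(\tilde A,\tilde B)|$ depends on $\tilde A$ only through the strategy $A$. For $r$-round strategies $S,T$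 with these input and output spaces, the *strategy fidelity* is $$F_r(S,T)=\min_{B}\ F\big(\rho_S(\tilde B),\rho_T(\tilde B)\big),\qquad F(P,Q)=\big\|\sqrt P\sqrt Q\big\|_1=\mathrm{Tr}\sqrt{\sqrt Q\,P\sqrt Q},$$ where $B$ ranges over all $r$-round co-strategies and $\tilde B$ is a purification of $B$ (with arbitrary memory spaces $\mathcal W_0,\dots,\mathcal W_r$). **Theorem (strategy generalization of Uhlmann's theorem).** Let $S,T$ be $r$-round strategies with the same input and output spaces, and let $\tilde S,\tilde T$ be any purifications of $S,T$ with a common final memory space $\mathcal Z_r$. Then the minimum defining $F_r(S,T)$ is attained, and $$F_r(S,T)^2=\max_{\Xi}\ \min_{\tilde B}\ \langle\psi(\tilde S,\tilde B)|\,\big[(\Xi\otimes I_{L(\mathcal W_r)})\big(|\psi(\tilde T,\tilde B)\rangle\langle\psi(\tilde T,\tilde B)|\big)\big]\,|\psi(\tilde S,\tilde B)\rangle ,$$ where the maximum is over all quantum channels (completely positive trace-preserving linear maps) $\Xi:L(\mathcal Z_r)\to L(\mathcal Z_r)$ and the minimum is over all $r$-round pure co-strategies $\tilde B$ (with arbitrary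 memory spaces $\mathcal W_0,\dots,\mathcal W_r$). The minimum is attained for every channel $\Xi$, and the maximum is attained. -/

import Mathlib

/-!
Complex Euclidean spaces are `ℂ^n` with their standard bases: vectors are functions on `Fin n`,
operators are matrices, and tensor products correspond to products of index types.

The message spaces of an `r`-round interaction are recorded as the list
`[(dim X₁, dim Y₁), …, (dim X_r, dim Y_r)]`.
-/

noncomputable section

namespace QStrat

open Matrix
open scoped MatrixOrder ComplexOrder

/-! ### Linear algebra -/

section LinearAlgebra

variable {I O M Z W : Type} [Fintype I] [Fintype O] [Fintype M] [Fintype Z] [Fintype W]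
  [DecidableEq I] [DecidableEq O] [DecidableEq M] [DecidableEq Z] [DecidableEq W]

/-- Partial trace over the second tensor factor. -/
def ptraceSnd (P : Matrix (O × M) (O × M) ℂ) : Matrix O O ℂ :=
  Matrix.of fun o o' => ∑ m, P (o, m) (o', m)

/-- Partial trace over the first tensor factor. -/
def ptraceFst (P : Matrix (Z × W) (Z × W) ℂ) : Matrix W W ℂ :=
  Matrix.of fun w w' => ∑ z, P (z, w) (z, w')

/-- The rank-one operator `|ψ⟩⟨ψ|`. -/
def ketbra (ψ : Z → ℂ) : Matrix Z Z ℂ :=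
  Matrix.vecMulVec ψ (star ψ)

/-- The map `X ↦ Tr_M (V X V*)` given by `V : ℂ^I → ℂ^O ⊗ ℂ^M`. -/
def stinespring (V : Matrix (O × M) I ℂ) (X : Matrix I I ℂ) : Matrix O O ℂ :=
  ptraceSnd (V * X * Vᴴ)

/-- The adjoint, with respect to the Hilbert–Schmidt inner product, of `stinespring V`:
the map `Y ↦ V* (Y ⊗ I_M) V`. -/
def stinespringAdjoint (V : Matrix (O × M) I ℂ) (Y : Matrix O O ℂ) : Matrix I I ℂ :=
  Vᴴ * (Matrix.kronecker Y (1 : Matrix M M ℂ)) * V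

/-- The Choi–Jamiołkowski representation `∑ Φ(|i⟩⟨i'|) ⊗ |i⟩⟨i'|` of a map `Φ`. -/
def choi (Φ : Matrix I I ℂ → Matrix O O ℂ) : Matrix (O × I) (O × I) ℂ :=
  Matrix.of fun p q => Φ (Matrix.single p.2 q.2 1) p.1 q.1

/-- The trace norm `Tr √(M* M)`. -/
def traceNorm (A : Matrix W W ℂ) : ℝ :=
  (Matrix.trace (CFC.sqrt (Aᴴ * A))).re

/-- The fidelity `‖√P √Q‖₁` of positive semidefinite operators. -/
def fidelity (P Q : Matrix W W ℂ) : ℝ :=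
  traceNorm (CFC.sqrt P * CFC.sqrt Q)

/-- The map `Ξ ⊗ I` on operators on `ℂ^Z ⊗ ℂ^W`. -/
def tensorId (Ξ : Matrix Z Z ℂ →ₗ[ℂ] Matrix Z Z ℂ) (P : Matrix (Z × W) (Z × W) ℂ) :
    Matrix (Z × W) (Z × W) ℂ :=
  Matrix.of fun p q => Ξ (Matrix.of fun a b => P (a, p.2) (b, q.2)) p.1 q.1

/-- Quantum channels: completely positive and trace-preserving linear maps. -/
structure IsChannel (Ξ : Matrix Z Z ℂ →ₗ[ℂ] Matrix Z Z ℂ) : Prop where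
  completelyPositive : ∀ (k : ℕ) (P : Matrix (Z × Fin k) (Z × Fin k) ℂ),
    P.PosSemidef → (tensorId Ξ P).PosSemidef
  tracePreserving : ∀ P : Matrix Z Z ℂ, (Ξ P).trace = P.trace

end LinearAlgebra

/-! ### Message spaces -/

/-- The list of message dimensions of an `r`-round interaction with input spaces of dimensions
`X` and output spaces of dimensions `Y`. -/
def rounds {r : ℕ} (X Y : Fin r → ℕ) : List (ℕ × ℕ) :=
  List.ofFn fun i => (X i, Y i)

/-- The dimension of the first space `X` of the list; after the last round there is only the
trivial message space `X_{r+1} = ℂ`. -/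
abbrev firstX : List (ℕ × ℕ) → ℕ
  | [] => 1
  | (x, _) :: _ => x

/-- Index set of the standard basis of `X₁ ⊗ ⋯ ⊗ X_r`. -/
def XIdx : List (ℕ × ℕ) → Type
  | [] => Unit
  | (x, _) :: l => Fin x × XIdx l

/-- Index set of the standard basis of `Y₁ ⊗ ⋯ ⊗ Y_r`. -/
def YIdx : List (ℕ × ℕ) → Type
  | [] => Unit
  | (_, y) :: l => Fin y × YIdx l

instance instFintypeXIdx : (l : List (ℕ × ℕ)) → Fintype (XIdx l)
  | [] => inferInstanceAs (Fintype Unit)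
  | (x, _) :: l =>
    letI := instFintypeXIdx l
    inferInstanceAs (Fintype (Fin x × XIdx l))

instance instFintypeYIdx : (l : List (ℕ × ℕ)) → Fintype (YIdx l)
  | [] => inferInstanceAs (Fintype Unit)
  | (_, y) :: l =>
    letI := instFintypeYIdx l
    inferInstanceAs (Fintype (Fin y × YIdx l))

instance instDecidableEqXIdx : (l : List (ℕ × ℕ)) → DecidableEq (XIdx l)
  | [] => inferInstanceAs (DecidableEq Unit)
  | (x, _) :: l =>
    letI := instDecidableEqXIdx l
    inferInstanceAs (DecidableEq (Fin x × XIdx l))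

instance instDecidableEqYIdx : (l : List (ℕ × ℕ)) → DecidableEq (YIdx l)
  | [] => inferInstanceAs (DecidableEq Unit)
  | (_, y) :: l =>
    letI := instDecidableEqYIdx l
    inferInstanceAs (DecidableEq (Fin y × YIdx l))

/-- The first component, in `X₁`, of a basis index of `X₁ ⊗ ⋯ ⊗ X_r`. -/
def XIdx.head {x y : ℕ} {l : List (ℕ × ℕ)} (p : XIdx ((x, y) :: l)) : Fin x :=
  Prod.fst (β := XIdx l) p

/-- The remaining components of a basis index of `X₁ ⊗ ⋯ ⊗ X_r`. -/
def XIdx.tail {x y : ℕ} {l : List (ℕ × ℕ)} (p : XIdx ((x, y) :: l)) : XIdx l :=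
  Prod.snd (α := Fin x) p

/-- The first component, in `Y₁`, of a basis index of `Y₁ ⊗ ⋯ ⊗ Y_r`. -/
def YIdx.head {x y : ℕ} {l : List (ℕ × ℕ)} (p : YIdx ((x, y) :: l)) : Fin y :=
  Prod.fst (β := YIdx l) p

/-- The remaining components of a basis index of `Y₁ ⊗ ⋯ ⊗ Y_r`. -/
def YIdx.tail {x y : ℕ} {l : List (ℕ × ℕ)} (p : YIdx ((x, y) :: l)) : YIdx l :=
  Prod.snd (α := Fin y) p

/-! ### Pure strategies -/

/-- `StrategyFrom l z zr`: the linear isometries `A_i : X_i ⊗ Z_{i-1} → Y_i ⊗ Z_i` of Alice for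
the rounds in `l`, starting from a memory space of dimension `z` and ending with a memory space of
dimension `zr`; the intermediate memory spaces are part of the data. -/
inductive StrategyFrom : List (ℕ × ℕ) → ℕ → ℕ → Type
  | nil (z : ℕ) : StrategyFrom [] z z
  | cons {x y : ℕ} {l : List (ℕ × ℕ)} {z z' zr : ℕ}
      (A : Matrix (Fin y × Fin z') (Fin x × Fin z) ℂ) (isometry : Aᴴ * A = 1)
      (rest : StrategyFrom l z' zr) : StrategyFrom ((x, y) :: l) z zr

/-- Pure strategies with final memory space `ℂ^zr`; the initial memory space is `Z₀ = ℂ`. -/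
abbrev PureStrategy (l : List (ℕ × ℕ)) (zr : ℕ) : Type := StrategyFrom l 1 zr

/-- The single operator `X₁ ⊗ ⋯ ⊗ X_r ⊗ Z₀ → Y₁ ⊗ ⋯ ⊗ Y_r ⊗ Z_r` composed of the `A_i`. -/
def StrategyFrom.op : {l : List (ℕ × ℕ)} → {z zr : ℕ} → StrategyFrom l z zr →
    Matrix (YIdx l × Fin zr) (XIdx l × Fin z) ℂ
  | _, _, _, .nil _ => Matrix.of fun p q => if p.2 = q.2 then 1 else 0
  | _, _, _, .cons A _ rest => Matrix.of fun p q =>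
      ∑ z', rest.op (p.1.tail, p.2) (q.1.tail, z') * A (p.1.head, z') (q.1.head, q.2)

/-- The linear isometry `X₁ ⊗ ⋯ ⊗ X_r → Y₁ ⊗ ⋯ ⊗ Y_r ⊗ Z_r` representing a pure strategy. -/
def PureStrategy.iso {l : List (ℕ × ℕ)} {zr : ℕ} (A : PureStrategy l zr) :
    Matrix (YIdx l × Fin zr) (XIdx l) ℂ :=
  Matrix.of fun p x => StrategyFrom.op A p (x, 0)

/-- The Choi–Jamiołkowski operator of the channel `Φ_A : X ↦ Tr_{Z_r} (A X A*)` obtained from a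
pure strategy by tracing out the final memory space. -/
def PureStrategy.toOp {l : List (ℕ × ℕ)} {zr : ℕ} (A : PureStrategy l zr) :
    Matrix (YIdx l × XIdx l) (YIdx l × XIdx l) ℂ :=
  choi (stinespring (PureStrategy.iso A))

/-! ### Pure co-strategies -/

/-- `CoStrategyFrom l w wr`: the linear isometries `B_i : Y_i ⊗ W_{i-1} → X_{i+1} ⊗ W_i` of Bob for
the rounds in `l`, starting from a memory space of dimension `w` and ending with one of dimension
`wr`; the intermediate memory spaces are part of the data. -/
inductive CoStrategyFrom : List (ℕ × ℕ) → ℕ → ℕ → Type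
  | nil (w : ℕ) : CoStrategyFrom [] w w
  | cons {x y : ℕ} {l : List (ℕ × ℕ)} {w w' wr : ℕ}
      (B : Matrix (Fin (firstX l) × Fin w') (Fin y × Fin w) ℂ) (isometry : Bᴴ * B = 1)
      (rest : CoStrategyFrom l w' wr) : CoStrategyFrom ((x, y) :: l) w wr

/-- Pure co-strategies with final memory space `ℂ^wr`: an initial pure state in `X₁ ⊗ W₀`
together with Bob's isometries. -/
structure PureCoStrategy (l : List (ℕ × ℕ)) (wr : ℕ) : Type where
  w₀ : ℕ
  init : Fin (firstX l) × Fin w₀ → ℂ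
  init_unit : ∑ p, ‖init p‖ ^ 2 = 1
  maps : CoStrategyFrom l w₀ wr

/-- The single operator `Y₁ ⊗ ⋯ ⊗ Y_r → X₁ ⊗ ⋯ ⊗ X_r ⊗ W_r` composed of the initial vector `β`
and the `B_i`. -/
def CoStrategyFrom.op : {l : List (ℕ × ℕ)} → {w wr : ℕ} → CoStrategyFrom l w wr →
    (Fin (firstX l) × Fin w → ℂ) → Matrix (XIdx l × Fin wr) (YIdx l) ℂ
  | _, _, _, .nil _, β => Matrix.of fun p _ => β ((0 : Fin 1), p.2)
  | _, _, _, .cons B _ rest, β => Matrix.of fun p y =>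
      rest.op (fun q => ∑ w, B q (y.head, w) * β (p.1.head, w)) (p.1.tail, p.2) y.tail

/-- The linear isometry `Y₁ ⊗ ⋯ ⊗ Y_r → X₁ ⊗ ⋯ ⊗ X_r ⊗ W_r` representing a pure co-strategy. -/
def PureCoStrategy.iso {l : List (ℕ × ℕ)} {wr : ℕ} (B : PureCoStrategy l wr) :
    Matrix (XIdx l × Fin wr) (YIdx l) ℂ :=
  B.maps.op B.init

/-- The Choi–Jamiołkowski operator of the adjoint of the channel `Ψ_B : Y ↦ Tr_{W_r} (B Y B*)`. -/
def PureCoStrategy.toOp {l : List (ℕ × ℕ)} {wr : ℕ} (B : PureCoStrategy l wr) :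
    Matrix (YIdx l × XIdx l) (YIdx l × XIdx l) ℂ :=
  choi (stinespringAdjoint (PureCoStrategy.iso B))

/-! ### The interaction -/

/-- Alice and Bob interact in the rounds of `l`, starting from the vector
`φ ∈ X₁ ⊗ Z₀ ⊗ W₀`: in each round Alice applies `A_i ⊗ I` and then Bob applies `I ⊗ B_i`. -/
def run : {l : List (ℕ × ℕ)} → {z zr w wr : ℕ} → StrategyFrom l z zr → CoStrategyFrom l w wr →
    (Fin (firstX l) × Fin z × Fin w → ℂ) → Fin zr × Fin wr → ℂ
  | _, _, _, _, _, .nil _, .nil _, φ => fun p => φ ((0 : Fin 1), p.1, p.2)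
  | _, _, _, _, _, .cons A _ restA, .cons B _ restB, φ =>
      run restA restB fun q =>
        ∑ y, ∑ w, B (q.1, q.2.2) (y, w) * ∑ x, ∑ z, A (y, q.2.1) (x, z) * φ (x, z, w)

/-- The final state `|ψ(A, B)⟩ ∈ Z_r ⊗ W_r` of the interaction. -/
def finalState {l : List (ℕ × ℕ)} {zr wr : ℕ} (A : PureStrategy l zr) (B : PureCoStrategy l wr) :
    Fin zr × Fin wr → ℂ :=
  run A B.maps fun q => B.init (q.1, q.2.2)

/-! ### Strategies, co-strategies and the strategy fidelity -/

/-- A strategy, given by its Choi–Jamiołkowski operator: what is obtained from some pure strategy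
by tracing out the final memory space. -/
structure Strategy (l : List (ℕ × ℕ)) : Type where
  op : Matrix (YIdx l × XIdx l) (YIdx l × XIdx l) ℂ
  exists_pure : ∃ (zr : ℕ) (A : PureStrategy l zr), PureStrategy.toOp A = op

/-- A co-strategy: what is obtained from some pure co-strategy by tracing out the final memory
space. -/
structure CoStrategy (l : List (ℕ × ℕ)) : Type where
  op : Matrix (YIdx l × XIdx l) (YIdx l × XIdx l) ℂ
  exists_pure : ∃ (wr : ℕ) (B : PureCoStrategy l wr), B.toOp = op

/-- `A` is a purification of the strategy `S`. -/
def Strategy.IsPurification {l : List (ℕ × ℕ)} (S : Strategy l) {zr : ℕ}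
    (A : PureStrategy l zr) : Prop :=
  PureStrategy.toOp A = S.op

/-- `Bt` is a purification of the co-strategy `B`. -/
def CoStrategy.IsPurification {l : List (ℕ × ℕ)} (B : CoStrategy l) {wr : ℕ}
    (Bt : PureCoStrategy l wr) : Prop :=
  Bt.toOp = B.op

/-- The reduced state `Tr_{Z_r} |ψ(A, B)⟩⟨ψ(A, B)|` on `W_r`, for some purification `A` of `S`
(all purifications give the same state). -/
def finalMix {l : List (ℕ × ℕ)} (S : Strategy l) {wr : ℕ} (B : PureCoStrategy l wr) :
    Matrix (Fin wr) (Fin wr) ℂ :=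
  ptraceFst (ketbra (finalState S.exists_pure.choose_spec.choose B))

/-- The fidelities between the reduced final states of `S` and `T`, over all co-strategies `B`
with a purification `Bt`. -/
def fidelityValues {l : List (ℕ × ℕ)} (S T : Strategy l) : Set ℝ :=
  {v | ∃ (B : CoStrategy l) (wr : ℕ) (Bt : PureCoStrategy l wr), B.IsPurification Bt ∧
    v = fidelity (finalMix S Bt) (finalMix T Bt)}

/-- The strategy fidelity. -/
def strategyFidelity {l : List (ℕ × ℕ)} (S T : Strategy l) : ℝ :=
  sInf (fidelityValues S T)

/-- The number `⟨ψ(S, B)| (Ξ ⊗ I)(|ψ(T, B)⟩⟨ψ(T, B)|) |ψ(S, B)⟩`, which is real when `Ξ` is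
a channel. -/
def overlap {l : List (ℕ × ℕ)} {zr wr : ℕ}
    (Ξ : Matrix (Fin zr) (Fin zr) ℂ →ₗ[ℂ] Matrix (Fin zr) (Fin zr) ℂ)
    (S T : PureStrategy l zr) (B : PureCoStrategy l wr) : ℝ :=
  (star (finalState S B) ⬝ᵥ (tensorId Ξ (ketbra (finalState T B)) *ᵥ finalState S B)).re

/-- The values of `overlap Ξ S T B` over all pure co-strategies `B`. -/
def overlapValues {l : List (ℕ × ℕ)} {zr : ℕ}
    (Ξ : Matrix (Fin zr) (Fin zr) ℂ →ₗ[ℂ] Matrix (Fin zr) (Fin zr) ℂ)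
    (S T : PureStrategy l zr) : Set ℝ :=
  {v | ∃ (wr : ℕ) (B : PureCoStrategy l wr), v = overlap Ξ S T B}

end QStrat

end

noncomputable section

namespace QStrat

open Matrix
open scoped MatrixOrder ComplexOrder

/-! ### The trace norm -/

section TraceNorm

set_option linter.unusedSectionVars false

variable {m n p : Type} [Fintype m] [Fintype n] [Fintype p]
  [DecidableEq m] [DecidableEq n] [DecidableEq p]

/-! Both optimization problems are functions of one matrix. For a pure co-strategy `B` let `C_B` be
the `crossGram` matrix of the two final states: their `W`-parts are paired, the `Z`-parts remain as
indices. The fidelity of the reduced states is the trace norm of `C_B`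
(`fidelity_ptraceFst_ketbra`), and for a channel with Kraus operators `K_k` the overlap is `∑
|Tr(K_kᵀ C_B)|²` (`star_dotProduct_tensorId_krausMap`). So everything takes place on the set
`gramSet` of all `C_B`.

This set is convex, because a direct sum of two co-strategies with weights `√a`, `√b` on the initial
states mixes their matrices (`convex_gramSet`). It is compact, because Bob's memory can be cut down
to bounded dimension round by round without changing `C_B` (`exists_boundedMemory`,
`isCompact_gramSet`). Hence all minima are attained.

Let `m` be the least trace norm on the set, attained at `C₀`. No channel does better than `m²`: its
overlap at `C₀` is at most `‖C₀‖₁²` (`sum_norm_trace_sq_le`). Conversely, if `m > 0`, the open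
trace-norm ball of radius `m` misses the convex set. A separating hyperplane, rescaled, is a
contraction `K` with `Re Tr(K C) ≥ m` on the whole set
(`exists_contraction_of_forall_le_nuclearNorm`). Completing `Kᵀ` to a channel gives overlap at least
`m²` against every co-strategy. Hahn–Banach and trace-norm duality thus play the role of a minimax
theorem. -/

lemma _root_.Matrix.PosSemidef.congr_eq {P Q : Matrix n n ℂ} (hP : P.PosSemidef) (h : Q = P) :
    Q.PosSemidef := h ▸ hP

/-- The identity `1 - KK* = K(1 - K*K)K* + (1 - KK*)²` writes the difference as a sum of positive
terms. -/
lemma mul_conjTranspose_self_le_one {K : Matrix m n ℂ} (hK : Kᴴ * K ≤ 1) : K * Kᴴ ≤ 1 := by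
  have h1 : (K * (1 - Kᴴ * K) * Kᴴ).PosSemidef :=
    (Matrix.le_iff.1 hK).mul_mul_conjTranspose_same K
  have h2 : ((1 - K * Kᴴ)ᴴ * (1 - K * Kᴴ)).PosSemidef := posSemidef_conjTranspose_mul_self _
  have h3 := h1.add h2
  rw [Matrix.le_iff]
  refine h3.congr_eq ?_
  simp only [conjTranspose_sub, conjTranspose_one, conjTranspose_mul, conjTranspose_conjTranspose,
    Matrix.mul_sub, Matrix.sub_mul, Matrix.mul_one, Matrix.one_mul, Matrix.mul_assoc]
  abel

lemma mul_mul_conjTranspose_le_one {K : Matrix m n ℂ} {L : Matrix n p ℂ}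
    (hK : Kᴴ * K ≤ 1) (hL : Lᴴ * L ≤ 1) : (K * L) * (K * L)ᴴ ≤ 1 := by
  have h1 : (K * (1 - L * Lᴴ) * Kᴴ).PosSemidef :=
    (Matrix.le_iff.1 (mul_conjTranspose_self_le_one hL)).mul_mul_conjTranspose_same K
  have h2 := h1.add (Matrix.le_iff.1 (mul_conjTranspose_self_le_one hK))
  rw [Matrix.le_iff]
  refine h2.congr_eq ?_
  simp only [conjTranspose_mul, Matrix.mul_sub, Matrix.sub_mul, Matrix.mul_one, Matrix.mul_assoc]
  abel

lemma trace_mul_nonneg {P Q : Matrix n n ℂ} (hP : P.PosSemidef) (hQ : Q.PosSemidef) :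
    0 ≤ (P * Q).trace := by
  obtain ⟨R, rfl⟩ := CStarAlgebra.nonneg_iff_eq_star_mul_self.mp hP.nonneg
  rw [Matrix.mul_assoc, trace_mul_comm]
  exact (hQ.mul_mul_conjTranspose_same R).trace_nonneg

/-- Add the two nonnegative quantities `Tr P(1-L)(1-L)*` and `Tr P(1-LL*)`: the terms in `LL*`
cancel, leaving `2 Tr P - 2 Re Tr(LP)`. -/
lemma re_trace_mul_le {P L : Matrix n n ℂ} (hP : P.PosSemidef) (hL : L * Lᴴ ≤ 1) :
    (L * P).trace.re ≤ P.trace.re := by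
  have h1 := trace_mul_nonneg hP (posSemidef_self_mul_conjTranspose (1 - L))
  have h2 := trace_mul_nonneg hP (Matrix.le_iff.1 hL)
  have h3 : (P * Lᴴ).trace = star (L * P).trace := by
    rw [← trace_conjTranspose, conjTranspose_mul, hP.isHermitian.eq]
  have h4 : (P * L).trace = (L * P).trace := trace_mul_comm _ _
  simp only [conjTranspose_sub, conjTranspose_one, Matrix.mul_sub, Matrix.sub_mul, Matrix.mul_one,
    Matrix.one_mul, trace_sub, h3, h4] at h1 h2
  have h1' := (Complex.le_def.1 h1).1
  have h2' := (Complex.le_def.1 h2).1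
  simp at h1' h2'
  linarith

/-- The trace norm `Tr √(M* M)` of a rectangular matrix. -/
def nuclearNorm (M : Matrix m n ℂ) : ℝ :=
  (Matrix.trace (CFC.sqrt (Mᴴ * M))).re

/-- Polar decomposition with a contraction in place of a unitary, which also serves rectangular and
singular matrices. Together with `re_trace_mul_le` it yields the duality between trace norm and
contractions. -/
lemma exists_polar (M : Matrix m n ℂ) : ∃ U : Matrix m n ℂ,
    U * CFC.sqrt (Mᴴ * M) = M ∧ Uᴴ * U ≤ 1 ∧ Uᴴ * M = CFC.sqrt (Mᴴ * M) := by
  have hH : (Mᴴ * M).PosSemidef := posSemidef_conjTranspose_mul_self M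
  set H := Mᴴ * M with hHdef
  have hsa : IsSelfAdjoint H := hH.isHermitian
  have hfin : (spectrum ℝ H).Finite := Matrix.finite_real_spectrum
  have hc : ∀ f : ℝ → ℝ, ContinuousOn f (spectrum ℝ H) := fun f => hfin.continuousOn f
  have hnn : ∀ t ∈ spectrum ℝ H, 0 ≤ t := fun t ht => spectrum_nonneg_of_nonneg hH.nonneg ht
  have hs : CFC.sqrt H = cfc Real.sqrt H := by
    rw [CFC.sqrt_eq_real_sqrt H hH.nonneg, cfcₙ_eq_cfc (hf := Real.continuous_sqrt.continuousOn)]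
  -- Since `0⁻¹ = 0`, `g` is the pseudo-inverse of `√H`, and `√H * g` is the support projection of
  -- `H`.
  set g : Matrix n n ℂ := cfc (fun t : ℝ => (Real.sqrt t)⁻¹) H with hg
  have hgs : gᴴ = g := (cfc_predicate (fun t : ℝ => (Real.sqrt t)⁻¹) H : IsSelfAdjoint _)
  have hgH : g * H = CFC.sqrt H := by
    rw [hs, hg]
    nth_rewrite 2 [← cfc_id ℝ H hsa]
    rw [← cfc_mul _ _ _ (hc _) (hc _)]
    refine cfc_congr fun t ht => ?_
    rcases (hnn t ht).eq_or_lt with h | h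
    · simp [← h]
    · have := Real.sqrt_pos.2 h
      simp only [id]
      field_simp
      rw [Real.sq_sqrt h.le]
  have hHg : H * g = CFC.sqrt H := by
    have := congrArg conjTranspose hgH
    rw [conjTranspose_mul, hgs, hH.isHermitian.eq] at this
    rw [this]
    exact (CFC.sqrt_nonneg H).posSemidef.isHermitian.eq
  have hsg : CFC.sqrt H * g ≤ 1 := by
    rw [hs, hg, ← cfc_mul _ _ _ (hc _) (hc _)]
    refine cfc_le_one _ _ fun t ht => ?_
    rcases (hnn t ht).eq_or_lt with h | h
    · simp [← h]
    · have := Real.sqrt_pos.2 h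
      exact (mul_inv_cancel₀ this.ne').le
  have hss : CFC.sqrt H * CFC.sqrt H = H := CFC.sqrt_mul_sqrt_self H hH.nonneg
  have hsstar : (CFC.sqrt H)ᴴ = CFC.sqrt H := (CFC.sqrt_nonneg H).posSemidef.isHermitian.eq
  have hHgs : H * (g * CFC.sqrt H) = H := by rw [← Matrix.mul_assoc, hHg, hss]
  refine ⟨M * g, ?_, ?_, ?_⟩
  -- A matrix with vanishing Gram matrix is zero; here both terms contain the factor `H - H g √H =
  -- 0`.
  · have h0 : (M - M * g * CFC.sqrt H)ᴴ * (M - M * g * CFC.sqrt H) = 0 := by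
      have e : (M - M * g * CFC.sqrt H)ᴴ * (M - M * g * CFC.sqrt H)
          = H - H * (g * CFC.sqrt H) - CFC.sqrt H * g * (H - H * (g * CFC.sqrt H)) := by
        simp only [hHdef, conjTranspose_sub, conjTranspose_mul, hgs, Matrix.mul_sub,
          Matrix.sub_mul, Matrix.mul_assoc]
        rw [← hHdef, hsstar]
        abel
      rw [e, hHgs]; simp
    have := conjTranspose_mul_self_eq_zero.1 h0
    exact (sub_eq_zero.1 this).symm
  · rw [conjTranspose_mul, hgs, Matrix.mul_assoc, ← Matrix.mul_assoc Mᴴ, ← hHdef,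
      ← Matrix.mul_assoc, hgH]
    exact hsg
  · rw [conjTranspose_mul, hgs, Matrix.mul_assoc, ← hHdef, hgH]

lemma re_trace_mul_le_nuclearNorm (M : Matrix m n ℂ) {K : Matrix n m ℂ} (hK : Kᴴ * K ≤ 1) :
    (K * M).trace.re ≤ nuclearNorm M := by
  obtain ⟨U, h1, h2, -⟩ := exists_polar M
  have h := re_trace_mul_le (CFC.sqrt_nonneg (Mᴴ * M)).posSemidef
    (mul_mul_conjTranspose_le_one hK h2)
  rwa [Matrix.mul_assoc, h1] at h

lemma exists_re_trace_mul_eq_nuclearNorm (M : Matrix m n ℂ) :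
    ∃ K : Matrix n m ℂ, Kᴴ * K ≤ 1 ∧ (K * M).trace.re = nuclearNorm M := by
  obtain ⟨U, -, h2, h3⟩ := exists_polar M
  refine ⟨Uᴴ, ?_, ?_⟩
  · rw [conjTranspose_conjTranspose]; exact mul_conjTranspose_self_le_one h2
  · rw [h3, nuclearNorm]

lemma nuclearNorm_nonneg (M : Matrix m n ℂ) : 0 ≤ nuclearNorm M :=
  (Complex.le_def.1 (CFC.sqrt_nonneg (Mᴴ * M)).posSemidef.trace_nonneg).1

lemma nuclearNorm_conjTranspose_le (M : Matrix m n ℂ) : nuclearNorm M ≤ nuclearNorm Mᴴ := by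
  obtain ⟨K, hK, h⟩ := exists_re_trace_mul_eq_nuclearNorm M
  rw [← h]
  have h1 := re_trace_mul_le_nuclearNorm Mᴴ (K := Kᴴ)
    (by rw [conjTranspose_conjTranspose]; exact mul_conjTranspose_self_le_one hK)
  rwa [← conjTranspose_mul, trace_conjTranspose, trace_mul_comm] at h1

lemma nuclearNorm_conjTranspose (M : Matrix m n ℂ) : nuclearNorm Mᴴ = nuclearNorm M :=
  le_antisymm (by simpa using nuclearNorm_conjTranspose_le Mᴴ) (nuclearNorm_conjTranspose_le M)

/-- The trace norm of `M` depends only on `M*M`, so a left factor `√(VV*)` may be replaced by `V*`.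
Taking adjoints allows the same replacement on the other side. -/
lemma fidelity_mul_conjTranspose (V : Matrix m n ℂ) (U : Matrix m p ℂ) :
    fidelity (V * Vᴴ) (U * Uᴴ) = nuclearNorm (Vᴴ * U) := by
  have hs : ∀ {k : Type} [Fintype k] (R : Matrix m k ℂ),
      (CFC.sqrt (R * Rᴴ))ᴴ = CFC.sqrt (R * Rᴴ) :=
    fun R => (CFC.sqrt_nonneg (R * Rᴴ)).posSemidef.isHermitian.eq
  have hss : ∀ {k : Type} [Fintype k] (R : Matrix m k ℂ),
      CFC.sqrt (R * Rᴴ) * CFC.sqrt (R * Rᴴ) = R * Rᴴ :=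
    fun R => CFC.sqrt_mul_sqrt_self _ (posSemidef_self_mul_conjTranspose R).nonneg
  have h1 : fidelity (V * Vᴴ) (U * Uᴴ) = nuclearNorm (Vᴴ * CFC.sqrt (U * Uᴴ)) := by
    simp only [fidelity, traceNorm, nuclearNorm]
    congr 3
    simp only [conjTranspose_mul, hs, conjTranspose_conjTranspose, Matrix.mul_assoc]
    rw [← Matrix.mul_assoc (CFC.sqrt (V * Vᴴ)), hss, Matrix.mul_assoc]
  have h2 : nuclearNorm (CFC.sqrt (U * Uᴴ) * V) = nuclearNorm (Uᴴ * V) := by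
    simp only [nuclearNorm]
    congr 3
    simp only [conjTranspose_mul, hs, conjTranspose_conjTranspose, Matrix.mul_assoc]
    rw [← Matrix.mul_assoc (CFC.sqrt (U * Uᴴ)), hss, Matrix.mul_assoc]
  rw [h1, ← nuclearNorm_conjTranspose, conjTranspose_mul, hs, conjTranspose_conjTranspose, h2,
    ← nuclearNorm_conjTranspose, conjTranspose_mul, conjTranspose_conjTranspose]

lemma nuclearNorm_add_le (M N : Matrix m n ℂ) :
    nuclearNorm (M + N) ≤ nuclearNorm M + nuclearNorm N := by
  obtain ⟨K, hK, h⟩ := exists_re_trace_mul_eq_nuclearNorm (M + N)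
  rw [← h, Matrix.mul_add, trace_add, Complex.add_re]
  exact add_le_add (re_trace_mul_le_nuclearNorm M hK) (re_trace_mul_le_nuclearNorm N hK)

lemma nuclearNorm_smul_le (c : ℝ) (hc : 0 ≤ c) (M : Matrix m n ℂ) :
    nuclearNorm (c • M) ≤ c * nuclearNorm M := by
  obtain ⟨K, hK, h⟩ := exists_re_trace_mul_eq_nuclearNorm (c • M)
  rw [← h, Matrix.mul_smul, trace_smul, Complex.smul_re]
  exact mul_le_mul_of_nonneg_left (re_trace_mul_le_nuclearNorm M hK) hc

lemma convexOn_nuclearNorm : ConvexOn ℝ Set.univ (nuclearNorm : Matrix m n ℂ → ℝ) :=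
  ⟨convex_univ, fun M _ N _ a b ha hb _ => (nuclearNorm_add_le _ _).trans
    (add_le_add (nuclearNorm_smul_le a ha M) (nuclearNorm_smul_le b hb N))⟩

/-- A contraction does not increase the norm of vectors. -/
lemma star_mulVec_dotProduct_le {K : Matrix m n ℂ} (hK : Kᴴ * K ≤ 1) (v : n → ℂ) :
    (star (K *ᵥ v) ⬝ᵥ (K *ᵥ v)).re ≤ (star v ⬝ᵥ v).re := by
  have h := (Matrix.le_iff.1 hK).dotProduct_mulVec_nonneg v
  rw [sub_mulVec, one_mulVec, dotProduct_sub, ← mulVec_mulVec, dotProduct_mulVec,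
    vecMul_conjTranspose, star_star] at h
  have := (Complex.le_def.1 h).1
  simp at this ⊢
  linarith

lemma norm_apply_le_one {K : Matrix m n ℂ} (hK : Kᴴ * K ≤ 1) (i : m) (j : n) : ‖K i j‖ ≤ 1 := by
  have h := star_mulVec_dotProduct_le hK (Pi.single j 1)
  have e : (star (K *ᵥ Pi.single j 1) ⬝ᵥ (K *ᵥ Pi.single j 1)).re = ∑ i, ‖K i j‖ ^ 2 := by
    simp [dotProduct, ← Complex.normSq_eq_norm_sq, Complex.normSq_apply]
  rw [e] at h
  have h1 : ‖K i j‖ ^ 2 ≤ 1 := by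
    refine (Finset.single_le_sum (f := fun i => ‖K i j‖ ^ 2) (fun _ _ => by positivity)
      (Finset.mem_univ i)).trans (h.trans ?_)
    simp [dotProduct, Pi.single_apply]
  exact (sq_le_one_iff₀ (norm_nonneg _)).1 h1

lemma nuclearNorm_le_sum (M : Matrix m n ℂ) : nuclearNorm M ≤ ∑ j, ∑ i, ‖M i j‖ := by
  obtain ⟨K, hK, h⟩ := exists_re_trace_mul_eq_nuclearNorm M
  rw [← h]
  refine (Complex.re_le_norm _).trans ?_
  simp only [trace, diag, mul_apply]
  refine (norm_sum_le _ _).trans (Finset.sum_le_sum fun j _ => (norm_sum_le _ _).trans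
    (Finset.sum_le_sum fun i _ => ?_))
  rw [norm_mul]
  exact mul_le_of_le_one_left (norm_nonneg _) (norm_apply_le_one hK _ _)

/-- By the triangle inequality, the change in trace norm is bounded by the entrywise `ℓ¹` norm of
the difference. -/
lemma continuous_nuclearNorm : Continuous (nuclearNorm : Matrix m n ℂ → ℝ) := by
  refine continuous_iff_continuousAt.2 fun M => ?_
  have hlim : Filter.Tendsto (fun N : Matrix m n ℂ => ∑ j, ∑ i, ‖(N - M) i j‖) (nhds M) (nhds 0) := by
    have : Continuous fun N : Matrix m n ℂ => ∑ j, ∑ i, ‖(N - M) i j‖ := by fun_prop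
    simpa using this.tendsto M
  refine tendsto_iff_dist_tendsto_zero.2 (squeeze_zero (fun _ => dist_nonneg) (fun N => ?_) hlim)
  rw [Real.dist_eq, abs_le]
  have h1 := nuclearNorm_add_le (N - M) M
  have h2 := nuclearNorm_add_le (M - N) N
  have h3 := nuclearNorm_le_sum (N - M)
  have h4 := nuclearNorm_le_sum (M - N)
  have h5 : ∑ j, ∑ i, ‖(M - N) i j‖ = ∑ j, ∑ i, ‖(N - M) i j‖ := by
    exact Finset.sum_congr rfl fun j _ => Finset.sum_congr rfl fun i _ => norm_sub_rev _ _
  simp only [sub_add_cancel] at h1 h2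
  constructor <;> linarith

end TraceNorm

/-! ### Separation from a trace-norm ball -/

section Separation

set_option linter.unusedSectionVars false

variable {n : Type} [Fintype n] [DecidableEq n]

lemma re_star_dotProduct_self_eq (v : n → ℂ) : (star v ⬝ᵥ v).re = ∑ i, ‖v i‖ ^ 2 := by
  simp [dotProduct, ← Complex.normSq_eq_norm_sq, Complex.normSq_apply]

/-- The trace norm of `|x⟩⟨y|` is at most `(‖x‖² + ‖y‖²) / 2`. -/
lemma nuclearNorm_vecMulVec_le (x y : n → ℂ) :
    2 * nuclearNorm (vecMulVec x (star y)) ≤ (star x ⬝ᵥ x).re + (star y ⬝ᵥ y).re := by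
  obtain ⟨K, hK, h⟩ := exists_re_trace_mul_eq_nuclearNorm (vecMulVec x (star y))
  rw [← h, mul_vecMulVec, trace_vecMulVec, dotProduct_comm]
  refine le_trans ?_ (add_le_add_left (star_mulVec_dotProduct_le hK x) _)
  rw [re_star_dotProduct_self_eq, re_star_dotProduct_self_eq, dotProduct, Complex.re_sum,
    Finset.mul_sum, ← Finset.sum_add_distrib]
  refine Finset.sum_le_sum fun i _ => ?_
  have h1 := Complex.re_le_norm (star y i * (K *ᵥ x) i)
  rw [norm_mul, Pi.star_apply, norm_star] at h1
  have h2 := sq_nonneg (‖(K *ᵥ x) i‖ - ‖y i‖)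
  simp only [Pi.star_apply] at h1 ⊢
  nlinarith

lemma conjTranspose_mul_self_le_one_of_forall {K : Matrix n n ℂ}
    (h : ∀ v, (star (K *ᵥ v) ⬝ᵥ (K *ᵥ v)).re ≤ (star v ⬝ᵥ v).re) : Kᴴ * K ≤ 1 := by
  rw [Matrix.le_iff]
  refine PosSemidef.of_dotProduct_mulVec_nonneg
    (isHermitian_one.sub (isHermitian_conjTranspose_mul_self K)) fun v => ?_
  have e : star v ⬝ᵥ ((1 - Kᴴ * K) *ᵥ v) = star v ⬝ᵥ v - star (K *ᵥ v) ⬝ᵥ (K *ᵥ v) := by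
    rw [sub_mulVec, one_mulVec, dotProduct_sub, ← mulVec_mulVec, dotProduct_mulVec,
      vecMul_conjTranspose, star_star]
  rw [e]
  have him : ∀ u : n → ℂ, (star u ⬝ᵥ u).im = 0 := fun u =>
    ((Complex.le_def.1 (dotProduct_star_self_nonneg u)).2).symm.trans rfl
  rw [Complex.le_def]
  refine ⟨?_, ?_⟩
  · simpa using h v
  · simp [him]

/-- Hahn–Banach separation of `𝒞` from the open ball of radius `m`. A functional bounded on the
trace-norm ball is, up to scale, the trace against a contraction. The same `K` serves every `C`,
which is the exchange of max and min. -/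
lemma exists_contraction_of_forall_le_nuclearNorm {𝒞 : Set (Matrix n n ℂ)} (hconv : Convex ℝ 𝒞)
    {m : ℝ} (hm : 0 < m) (h : ∀ C ∈ 𝒞, m ≤ nuclearNorm C) :
    ∃ K : Matrix n n ℂ, Kᴴ * K ≤ 1 ∧ ∀ C ∈ 𝒞, m ≤ (K * C).trace.re := by
  have hball : Convex ℝ {C : Matrix n n ℂ | nuclearNorm C < m} := by
    simpa using (convexOn_nuclearNorm (m := n) (n := n)).convex_lt m
  have hopen : IsOpen {C : Matrix n n ℂ | nuclearNorm C < m} :=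
    isOpen_lt continuous_nuclearNorm continuous_const
  obtain ⟨f, u, hf, hu⟩ := RCLike.geometric_hahn_banach_open (𝕜 := ℂ) hball hopen hconv
    (Set.disjoint_left.2 fun C hC hC' => absurd (h C hC') (not_le.2 hC))
  -- The matrix that represents the separating functional through the trace pairing; hence the
  -- swapped indices.
  let K : Matrix n n ℂ := Matrix.of fun j i => f (Matrix.single i j 1)
  have hfK : ∀ C, f C = (K * C).trace := by
    intro C
    conv_lhs => rw [matrix_eq_sum_single C]
    simp only [map_sum, trace, diag, mul_apply]
    rw [Finset.sum_comm]
    refine Finset.sum_congr rfl fun j _ => Finset.sum_congr rfl fun i _ => ?_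
    have : Matrix.single i j (C i j) = C i j • Matrix.single i j (1 : ℂ) := by simp
    rw [this, map_smul, smul_eq_mul, mul_comm]; rfl
  have hf' : ∀ C, nuclearNorm C < m → (K * C).trace.re < u := fun C hC => by
    rw [← hfK]; exact hf C hC
  have hu0 : 0 < u := by
    have := hf' 0 (lt_of_le_of_lt (nuclearNorm_le_sum 0) (by simpa using hm))
    simpa using this
  have hc : 0 < m / u := div_pos hm hu0
  -- The functional stays below `u` on the ball of radius `m`, so this rescaling normalizes it to
  -- dual norm at most one while moving the threshold on `𝒞` from `u` to `m`.
  refine ⟨(m / u : ℝ) • K, ?_, fun C hC => ?_⟩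
  · refine conjTranspose_mul_self_le_one_of_forall fun v => ?_
    by_contra! hlt
    set w := ((m / u : ℝ) • K) *ᵥ v with hw
    set a := (star v ⬝ᵥ v).re with ha
    set b := (star w ⬝ᵥ w).re with hb
    have ha0 : 0 ≤ a := (Complex.le_def.1 (dotProduct_star_self_nonneg v)).1
    have hb0 : 0 < b := ha0.trans_lt hlt
    -- `t |v⟩⟨w|` lies in the ball as soon as `t (a + b) / 2 < m`
    have ht : nuclearNorm ((m / b : ℝ) • vecMulVec v (star w)) < m := by
      refine (nuclearNorm_smul_le _ (by positivity) _).trans_lt ?_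
      have := nuclearNorm_vecMulVec_le v w
      rw [div_mul_eq_mul_div, div_lt_iff₀ hb0]
      exact mul_lt_mul_of_pos_left (by linarith) hm
    -- On this rank-one matrix the functional takes exactly the value `(m/b)(u/m)b = u`,
    -- contradicting the strict bound inside the ball.
    have h1 := hf' _ ht
    rw [Matrix.mul_smul, trace_smul, Complex.smul_re, mul_vecMulVec, trace_vecMulVec] at h1
    have h2 : K *ᵥ v = ((m / u)⁻¹ : ℝ) • w := by
      rw [hw, smul_mulVec, smul_smul, inv_mul_cancel₀ hc.ne', one_smul]
    rw [h2, smul_dotProduct, dotProduct_comm, Complex.smul_re, ← hb] at h1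
    simp only [smul_eq_mul] at h1
    field_simp at h1
    exact lt_irrefl _ h1
  · have h1 : u ≤ (K * C).trace.re := by rw [← hfK]; exact hu C hC
    rw [Matrix.smul_mul, trace_smul, Complex.smul_re, smul_eq_mul, div_mul_eq_mul_div,
      le_div_iff₀ hu0]
    exact mul_le_mul_of_nonneg_left h1 hm.le

end Separation

/-! ### Channels -/

section Channels

set_option linter.unusedSectionVars false

variable {ι Z W : Type} [Fintype ι] [Fintype Z] [Fintype W]
  [DecidableEq ι] [DecidableEq Z] [DecidableEq W]

/-- The matrix `∑_w ψ(z', w)* φ(z, w)` of overlaps of the `W`-parts of two vectors. -/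
def crossGram (ψ φ : Z × W → ℂ) : Matrix Z Z ℂ :=
  Matrix.of fun z' z => ∑ w, star (ψ (z', w)) * φ (z, w)

/-- The completely positive map with Kraus operators `K`. -/
def krausMap (K : ι → Matrix Z Z ℂ) : Matrix Z Z ℂ →ₗ[ℂ] Matrix Z Z ℂ where
  toFun P := ∑ k, K k * P * (K k)ᴴ
  map_add' P Q := by simp [Matrix.mul_add, Matrix.add_mul, Finset.sum_add_distrib]
  map_smul' c P := by simp [Finset.smul_sum]

lemma krausMap_apply (K : ι → Matrix Z Z ℂ) (P : Matrix Z Z ℂ) :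
    krausMap K P = ∑ k, K k * P * (K k)ᴴ := rfl

/-- The operator `K ⊗ I` on `ℂ^Z ⊗ ℂ^W`. -/
def ampliation (W : Type) [DecidableEq W] (K : Matrix Z Z ℂ) : Matrix (Z × W) (Z × W) ℂ :=
  Matrix.of fun p q => if p.2 = q.2 then K p.1 q.1 else 0

lemma tensorId_krausMap (K : ι → Matrix Z Z ℂ) (P : Matrix (Z × W) (Z × W) ℂ) :
    tensorId (krausMap K) P = ∑ k, ampliation W (K k) * P * (ampliation W (K k))ᴴ := by
  ext ⟨z, w⟩ ⟨z', w'⟩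
  simp only [tensorId, krausMap_apply, of_apply, Matrix.sum_apply, mul_apply, ampliation,
    conjTranspose_apply, Fintype.sum_prod_type, ite_mul, mul_ite, mul_zero,
    zero_mul, Finset.sum_ite_eq, Finset.mem_univ, if_true, apply_ite star, star_zero]

lemma isChannel_krausMap {K : ι → Matrix Z Z ℂ} (hK : ∑ k, (K k)ᴴ * K k = 1) :
    IsChannel (krausMap K) where
  completelyPositive k P hP := by
    rw [tensorId_krausMap]
    exact posSemidef_sum _ fun i _ => hP.mul_mul_conjTranspose_same _
  tracePreserving P := by
    rw [krausMap_apply, trace_sum]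
    simp_rw [trace_mul_comm _ (K _)ᴴ, ← Matrix.mul_assoc]
    rw [← trace_sum, ← Finset.sum_mul, hK, Matrix.one_mul]

/-- Each Kraus operator contributes `|⟨ψ|(K ⊗ I)|φ⟩|²`, and this amplitude is a trace against
`crossGram ψ φ`. The transpose comes from `crossGram` having the index of `ψ` first. -/
lemma star_dotProduct_tensorId_krausMap (K : ι → Matrix Z Z ℂ) (ψ φ : Z × W → ℂ) :
    star ψ ⬝ᵥ (tensorId (krausMap K) (ketbra φ) *ᵥ ψ) =
      ((∑ k, ‖((K k)ᵀ * crossGram ψ φ).trace‖ ^ 2 : ℝ) : ℂ) := by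
  have key : ∀ k, star ψ ⬝ᵥ (ampliation W (K k) *ᵥ φ) = ((K k)ᵀ * crossGram ψ φ).trace := by
    intro k
    simp only [dotProduct, mulVec, trace, diag, mul_apply, transpose_apply, crossGram, of_apply,
      Fintype.sum_prod_type, ampliation, ite_mul, zero_mul, Finset.sum_ite_eq, Finset.mem_univ,
      if_true, Finset.mul_sum, Pi.star_apply]
    rw [Finset.sum_comm (s := Finset.univ (α := Z)) (t := Finset.univ (α := Z))]
    refine Finset.sum_congr rfl fun z _ => ?_
    rw [Finset.sum_comm]
    exact Finset.sum_congr rfl fun _ _ => Finset.sum_congr rfl fun _ _ => by ring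
  rw [tensorId_krausMap, sum_mulVec, dotProduct_sum]
  push_cast
  refine Finset.sum_congr rfl fun k _ => ?_
  rw [← key, ketbra, mul_vecMulVec, vecMulVec_mul, vecMul_conjTranspose, star_star,
    vecMulVec_mulVec, dotProduct_smul, ← Complex.mul_conj', starRingEnd_apply, star_dotProduct]
  simp

/-- Kraus decomposition of a channel. -/
lemma IsChannel.exists_kraus {d : ℕ} {Ξ : Matrix (Fin d) (Fin d) ℂ →ₗ[ℂ] Matrix (Fin d) (Fin d) ℂ}
    (hΞ : IsChannel Ξ) : ∃ K : Fin d × Fin d → Matrix (Fin d) (Fin d) ℂ,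
      Ξ = krausMap K ∧ ∑ k, (K k)ᴴ * K k = 1 := by
  -- The image of the unnormalized maximally entangled state is the Choi matrix. Factoring it as
  -- `VV*`, the columns of `V`, reshaped, are the Kraus operators.
  have hJ := hΞ.completelyPositive d (ketbra fun p => if p.1 = p.2 then 1 else 0)
    (posSemidef_vecMulVec_self_star _)
  obtain ⟨V, hV⟩ := CStarAlgebra.nonneg_iff_eq_mul_star_self.mp hJ.nonneg
  have hs : ∀ a b p q, Ξ (Matrix.single a b 1) p q = ∑ k, V (p, a) k * star (V (q, b) k) := by
    intro a b p q
    have := congrFun (congrFun hV (p, a)) (q, b)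
    rw [mul_apply] at this
    simp only [star_apply] at this
    rw [← this, tensorId, of_apply]
    refine congrArg (fun M => Ξ M p q) ?_
    ext a' b'
    simp only [ketbra, vecMulVec_apply, of_apply, Pi.star_apply, single_apply, eq_comm (a := a),
      eq_comm (a := b)]
    by_cases h1 : a' = a <;> by_cases h2 : b' = b <;> simp [h1, h2]
  have hΞK : Ξ = krausMap fun k => Matrix.of fun p a => V (p, a) k := by
    refine LinearMap.ext fun P => ?_
    ext p q
    conv_lhs => rw [matrix_eq_sum_single P]
    simp only [map_sum, Matrix.sum_apply, krausMap_apply, mul_apply, conjTranspose_apply, of_apply]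
    have : ∀ a b, Matrix.single a b (P a b) = P a b • Matrix.single a b (1 : ℂ) := by simp
    simp only [this, map_smul, Matrix.smul_apply, hs, smul_eq_mul, Finset.mul_sum, Finset.sum_mul]
    rw [Finset.sum_comm]
    refine (Finset.sum_congr rfl fun _ _ => Finset.sum_comm).trans (Finset.sum_comm.trans ?_)
    exact Finset.sum_congr rfl fun _ _ => Finset.sum_congr rfl fun _ _ =>
      Finset.sum_congr rfl fun _ _ => by ring
  refine ⟨_, hΞK, ?_⟩
  ext b a
  have h1 := hΞ.tracePreserving (Matrix.single a b 1)
  simp only [trace, diag, hs] at h1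
  simp only [Matrix.sum_apply, mul_apply, conjTranspose_apply, of_apply]
  rw [Finset.sum_comm]
  simp_rw [mul_comm (star _)]
  rw [h1]
  by_cases h : a = b
  · subst h; simp [single_apply]
  · rw [one_apply_ne (Ne.symm h)]
    refine Finset.sum_eq_zero fun i _ => ?_
    rw [single_apply, if_neg]
    rintro ⟨rfl, rfl⟩; exact h rfl

lemma transpose_contraction {m n : Type} [Fintype m] [Fintype n] [DecidableEq m] [DecidableEq n]
    {K : Matrix m n ℂ} (hK : Kᴴ * K ≤ 1) : Kᵀᴴ * Kᵀ ≤ 1 := by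
  have h := (Matrix.le_iff.1 (mul_conjTranspose_self_le_one hK)).transpose
  rw [Matrix.le_iff]
  refine h.congr_eq ?_
  simp only [transpose_sub, transpose_one, transpose_mul]
  rfl

/-- With `t k` the individual traces and `s` their `ℓ²` norm, the combination `∑ s⁻¹ (t k)* K k` is
a contraction because its coefficients form a unit vector. Its transpose has trace exactly `s`
against `C`, so duality gives `s ≤ ‖C‖₁`. -/
lemma sum_norm_trace_sq_le {K : ι → Matrix Z Z ℂ} (hK : ∑ k, (K k)ᴴ * K k = 1)
    (C : Matrix Z Z ℂ) : ∑ k, ‖((K k)ᵀ * C).trace‖ ^ 2 ≤ nuclearNorm C ^ 2 := by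
  set t : ι → ℂ := fun k => ((K k)ᵀ * C).trace with ht
  set s : ℝ := Real.sqrt (∑ k, ‖t k‖ ^ 2) with hs
  have hs2 : s ^ 2 = ∑ k, ‖t k‖ ^ 2 := Real.sq_sqrt (Finset.sum_nonneg fun _ _ => by positivity)
  change ∑ k, ‖t k‖ ^ 2 ≤ _
  rw [← hs2]
  rcases (Real.sqrt_nonneg (∑ k, ‖t k‖ ^ 2)).eq_or_lt with h0 | h0
  · rw [hs, ← h0, zero_pow two_ne_zero]; positivity
  rw [← hs] at h0
  refine pow_le_pow_left₀ h0.le ?_ 2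
  -- `Q` stacks the Kraus operators into an isometry and `R` is the coisometry `⟨t/s| ⊗ I`; their
  -- product is the combined operator.
  let R : Matrix Z (ι × Z) ℂ := Matrix.of fun z p => if z = p.2 then (s⁻¹ : ℝ) * star (t p.1) else 0
  let Q : Matrix (ι × Z) Z ℂ := Matrix.of fun p z => K p.1 p.2 z
  have hQ : Qᴴ * Q ≤ 1 := by
    refine le_of_eq ?_
    rw [← hK]
    ext a b
    simp [Q, mul_apply, Fintype.sum_prod_type, Matrix.sum_apply]
  have hR : R * Rᴴ = 1 := by
    ext a b
    have : ∀ k, ((s⁻¹ : ℝ) * star (t k)) * star ((s⁻¹ : ℝ) * star (t k)) =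
        (((s⁻¹) ^ 2 * ‖t k‖ ^ 2 : ℝ) : ℂ) := by
      intro k
      rw [star_mul', star_star, ← starRingEnd_apply ((s⁻¹ : ℝ) : ℂ), Complex.conj_ofReal,
        Complex.ofReal_mul, Complex.ofReal_pow, Complex.ofReal_pow, ← Complex.mul_conj',
        starRingEnd_apply]
      ring
    simp only [R, mul_apply, Fintype.sum_prod_type, conjTranspose_apply, of_apply, ite_mul,
      zero_mul, Finset.sum_ite_eq, Finset.mem_univ, if_true]
    by_cases h : a = b
    · subst h
      simp only [if_true, this, one_apply_eq]
      rw [← Complex.ofReal_sum, ← Finset.mul_sum, ← hs2, ← mul_pow, inv_mul_cancel₀ h0.ne']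
      simp
    · rw [one_apply_ne h]
      refine Finset.sum_eq_zero fun k _ => ?_
      rw [if_neg (Ne.symm h)]; simp
  have hRc : Rᴴ * R ≤ 1 := by
    have := mul_conjTranspose_self_le_one (K := Rᴴ)
      (by rw [conjTranspose_conjTranspose]; exact hR.le)
    rwa [conjTranspose_conjTranspose] at this
  have hRQ : (R * Q)ᴴ * (R * Q) ≤ 1 := by
    have := mul_conjTranspose_self_le_one (K := (R * Q)ᴴ)
      (by rw [conjTranspose_conjTranspose]; exact mul_mul_conjTranspose_le_one hRc hQ)
    rwa [conjTranspose_conjTranspose] at this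
  refine le_trans (le_of_eq ?_) (re_trace_mul_le_nuclearNorm C (transpose_contraction hRQ))
  have e : (R * Q)ᵀ = ∑ k, ((s⁻¹ : ℝ) * star (t k)) • (K k)ᵀ := by
    ext a b
    simp [R, Q, mul_apply, Fintype.sum_prod_type, Matrix.sum_apply]
  rw [e, Finset.sum_mul, trace_sum]
  have e2 : ∀ k, (((s⁻¹ : ℝ) * star (t k)) • (K k)ᵀ * C).trace = ((s⁻¹ * ‖t k‖ ^ 2 : ℝ) : ℂ) := by
    intro k
    rw [Matrix.smul_mul, trace_smul, smul_eq_mul]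
    push_cast
    rw [← Complex.conj_mul', ← starRingEnd_apply, mul_assoc]
  simp only [e2]
  rw [← Complex.ofReal_sum, ← Finset.mul_sum, ← hs2, Complex.ofReal_re]
  field_simp

/-- A contraction is one of the Kraus operators of some channel. -/
lemma exists_channel_of_contraction {K : Matrix Z Z ℂ} (hK : Kᴴ * K ≤ 1) :
    ∃ L : Bool → Matrix Z Z ℂ, ∑ k, (L k)ᴴ * L k = 1 ∧ L true = K := by
  have h : (0 : Matrix Z Z ℂ) ≤ 1 - Kᴴ * K := (Matrix.le_iff.1 hK).nonneg
  refine ⟨fun k => if k then K else CFC.sqrt (1 - Kᴴ * K), ?_, rfl⟩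
  simp only [Fintype.sum_bool, if_true, Bool.false_eq_true, if_false]
  rw [(CFC.sqrt_nonneg (1 - Kᴴ * K)).posSemidef.isHermitian.eq, CFC.sqrt_mul_sqrt_self _ h]
  abel

end Channels

/-! ### Linearity of the interaction -/

section Interaction

/-- Alice's move applied to a vector in `X ⊗ Z ⊗ W`; the result lies in `Z' ⊗ (Y ⊗ W)`. -/
def aliceMove {x y z z' w : ℕ} (A : Matrix (Fin y × Fin z') (Fin x × Fin z) ℂ)
    (φ : Fin x × Fin z × Fin w → ℂ) : Fin z' × (Fin y × Fin w) → ℂ :=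
  fun q => ∑ a, ∑ b, A (q.2.1, q.1) (a, b) * φ (a, b, q.2.2)

/-- An operator `ℂ^I → X ⊗ W` applied to a vector in `Z ⊗ ℂ^I`. -/
def bobMove {x z w : ℕ} {I : Type} [Fintype I] (B : Matrix (Fin x × Fin w) I ℂ)
    (η : Fin z × I → ℂ) : Fin x × Fin z × Fin w → ℂ :=
  fun q => ∑ i, B (q.1, q.2.2) i * η (q.2.1, i)

lemma run_nil {z w : ℕ} (φ : Fin (firstX []) × Fin z × Fin w → ℂ) :
    run (.nil z) (.nil w) φ = fun p => φ ((0 : Fin 1), p.1, p.2) := rfl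

lemma run_cons {x y : ℕ} {l : List (ℕ × ℕ)} {z z' zr w w' wr : ℕ}
    (A : Matrix (Fin y × Fin z') (Fin x × Fin z) ℂ) (hA : Aᴴ * A = 1) (restA : StrategyFrom l z' zr)
    (B : Matrix (Fin (firstX l) × Fin w') (Fin y × Fin w) ℂ) (hB : Bᴴ * B = 1)
    (restB : CoStrategyFrom l w' wr) (φ : Fin x × Fin z × Fin w → ℂ) :
    run (.cons A hA restA) (.cons (x := x) B hB restB) φ =
      run restA restB (bobMove B (aliceMove A φ)) := by
  have h : (fun q : Fin (firstX l) × Fin z' × Fin w' =>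
      ∑ y, ∑ w, B (q.1, q.2.2) (y, w) * ∑ x, ∑ z, A (y, q.2.1) (x, z) * φ (x, z, w)) =
      bobMove B (aliceMove A φ) := by
    funext q
    simp only [bobMove, aliceMove, Fintype.sum_prod_type]
  rw [← h, run]

lemma aliceMove_sum {x y z z' w : ℕ} (A : Matrix (Fin y × Fin z') (Fin x × Fin z) ℂ)
    {ι : Type} [Fintype ι] (c : ι → ℂ) (φ : ι → Fin x × Fin z × Fin w → ℂ) :
    aliceMove A (∑ i, c i • φ i) = ∑ i, c i • aliceMove A (φ i) := by
  funext q
  simp only [aliceMove, Finset.sum_apply, Pi.smul_apply, smul_eq_mul, Finset.mul_sum]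
  refine (Finset.sum_congr rfl fun _ _ => Finset.sum_comm).trans (Finset.sum_comm.trans ?_)
  exact Finset.sum_congr rfl fun _ _ => Finset.sum_congr rfl fun _ _ =>
    Finset.sum_congr rfl fun _ _ => by ring

lemma bobMove_sum {x z w : ℕ} {I : Type} [Fintype I] (B : Matrix (Fin x × Fin w) I ℂ)
    {ι : Type} [Fintype ι] (c : ι → ℂ) (η : ι → Fin z × I → ℂ) :
    bobMove B (∑ i, c i • η i) = ∑ i, c i • bobMove B (η i) := by
  funext q
  simp only [bobMove, Finset.sum_apply, Pi.smul_apply, smul_eq_mul, Finset.mul_sum]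
  rw [Finset.sum_comm]
  exact Finset.sum_congr rfl fun _ _ => Finset.sum_congr rfl fun _ _ => by ring

lemma run_sum {l : List (ℕ × ℕ)} {z zr w wr : ℕ} (A : StrategyFrom l z zr)
    (B : CoStrategyFrom l w wr) {ι : Type} [Fintype ι] (c : ι → ℂ)
    (φ : ι → Fin (firstX l) × Fin z × Fin w → ℂ) :
    run A B (∑ i, c i • φ i) = ∑ i, c i • run A B (φ i) := by
  induction A generalizing w with
  | nil z =>
    cases B
    funext p
    simp [run_nil, Finset.sum_apply]
  | cons A hA restA ih =>
    cases B with
    | cons B hB restB => simp only [run_cons, aliceMove_sum, bobMove_sum, ih]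

lemma run_zero {l : List (ℕ × ℕ)} {z zr w wr : ℕ} (A : StrategyFrom l z zr)
    (B : CoStrategyFrom l w wr) : run A B 0 = 0 := by
  simpa using run_sum A B (ι := Empty) (fun _ => 0) (fun _ => 0)

lemma run_smul {l : List (ℕ × ℕ)} {z zr w wr : ℕ} (A : StrategyFrom l z zr)
    (B : CoStrategyFrom l w wr) (c : ℂ) (φ : Fin (firstX l) × Fin z × Fin w → ℂ) :
    run A B (c • φ) = c • run A B φ := by
  simpa using run_sum A B (ι := Unit) (fun _ => c) (fun _ => φ)

end Interaction

/-! ### Direct sums of co-strategies -/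

section DirectSum

/-- The operator `B₁ ⊕ B₂` on direct sums of memory spaces. -/
def memSum {X Y : Type} {w₁ w₂ w₁' w₂' : ℕ} (B₁ : Matrix (X × Fin w₁') (Y × Fin w₁) ℂ)
    (B₂ : Matrix (X × Fin w₂') (Y × Fin w₂) ℂ) :
    Matrix (X × Fin (w₁' + w₂')) (Y × Fin (w₁ + w₂)) ℂ :=
  Matrix.of fun p q =>
    Fin.addCases (motive := fun _ => ℂ)
      (fun a => Fin.addCases (motive := fun _ => ℂ) (fun b => B₁ (p.1, a) (q.1, b)) (fun _ => 0) q.2)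
      (fun a => Fin.addCases (motive := fun _ => ℂ) (fun _ => 0) (fun b => B₂ (p.1, a) (q.1, b)) q.2)
      p.2

lemma memSum_isometry {X Y : Type} [Fintype X] [DecidableEq Y]
    {w₁ w₂ w₁' w₂' : ℕ} {B₁ : Matrix (X × Fin w₁') (Y × Fin w₁) ℂ}
    {B₂ : Matrix (X × Fin w₂') (Y × Fin w₂) ℂ} (h₁ : B₁ᴴ * B₁ = 1) (h₂ : B₂ᴴ * B₂ = 1) :
    (memSum B₁ B₂)ᴴ * memSum B₁ B₂ = 1 := by
  ext ⟨y, w⟩ ⟨y', w'⟩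
  simp only [mul_apply, conjTranspose_apply, Fintype.sum_prod_type, Fin.sum_univ_add, memSum,
    of_apply, Fin.addCases_left, Fin.addCases_right]
  induction w using Fin.addCases with
  | left w =>
    induction w' using Fin.addCases with
    | left w' =>
      have := congrFun (congrFun h₁ (y, w)) (y', w')
      simp only [mul_apply, conjTranspose_apply, Fintype.sum_prod_type] at this
      simp only [Fin.addCases_left, star_zero, zero_mul, Finset.sum_const_zero, add_zero, this,
        one_apply, Prod.mk.injEq, Fin.castAdd_inj]
    | right w' =>
      rw [one_apply_ne]
      · simp
      · simp [Fin.ext_iff]; omega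
  | right w =>
    induction w' using Fin.addCases with
    | left w' =>
      rw [one_apply_ne]
      · simp
      · simp [Fin.ext_iff]; omega
    | right w' =>
      have := congrFun (congrFun h₂ (y, w)) (y', w')
      simp only [mul_apply, conjTranspose_apply, Fintype.sum_prod_type] at this
      simp only [Fin.addCases_right, star_zero, zero_mul, Finset.sum_const_zero, zero_add, this,
        one_apply, Prod.mk.injEq, Fin.natAdd_inj]

/-- The direct sum of two co-strategies. -/
def CoStrategyFrom.sum : {l : List (ℕ × ℕ)} → {w₁ wr₁ w₂ wr₂ : ℕ} → CoStrategyFrom l w₁ wr₁ →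
    CoStrategyFrom l w₂ wr₂ → CoStrategyFrom l (w₁ + w₂) (wr₁ + wr₂)
  | _, _, _, _, _, .nil w₁, .nil w₂ => .nil (w₁ + w₂)
  | _, _, _, _, _, .cons B₁ h₁ rest₁, .cons B₂ h₂ rest₂ =>
      .cons (memSum B₁ B₂) (memSum_isometry h₁ h₂) (rest₁.sum rest₂)

/-- The first component of a vector in `X ⊗ Z ⊗ (W₁ ⊕ W₂)`. -/
def memFst {x z w₁ w₂ : ℕ} (φ : Fin x × Fin z × Fin (w₁ + w₂) → ℂ) : Fin x × Fin z × Fin w₁ → ℂ :=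
  fun q => φ (q.1, q.2.1, Fin.castAdd w₂ q.2.2)

/-- The second component of a vector in `X ⊗ Z ⊗ (W₁ ⊕ W₂)`. -/
def memSnd {x z w₁ w₂ : ℕ} (φ : Fin x × Fin z × Fin (w₁ + w₂) → ℂ) : Fin x × Fin z × Fin w₂ → ℂ :=
  fun q => φ (q.1, q.2.1, Fin.natAdd w₁ q.2.2)

/-- Bob's operators are block diagonal in his memory and Alice does not touch it, so the two blocks
evolve independently. -/
lemma run_coSum {l : List (ℕ × ℕ)} {z zr w₁ wr₁ w₂ wr₂ : ℕ} (A : StrategyFrom l z zr)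
    (B₁ : CoStrategyFrom l w₁ wr₁) (B₂ : CoStrategyFrom l w₂ wr₂)
    (φ : Fin (firstX l) × Fin z × Fin (w₁ + w₂) → ℂ) (k : Fin zr) :
    (∀ w, run A (B₁.sum B₂) φ (k, Fin.castAdd wr₂ w) = run A B₁ (memFst φ) (k, w)) ∧
    (∀ w, run A (B₁.sum B₂) φ (k, Fin.natAdd wr₁ w) = run A B₂ (memSnd φ) (k, w)) := by
  induction A generalizing w₁ w₂ with
  | nil z =>
    cases B₁; cases B₂
    exact ⟨fun _ => rfl, fun _ => rfl⟩
  | cons A hA restA ih =>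
    cases B₁ with
    | cons B₁ h₁ rest₁ =>
      cases B₂ with
      | cons B₂ h₂ rest₂ =>
        have e₁ : memFst (bobMove (memSum B₁ B₂) (aliceMove A φ)) =
            bobMove B₁ (aliceMove A (memFst φ)) := by
          funext q
          simp [memFst, bobMove, aliceMove, memSum, Fintype.sum_prod_type, Fin.sum_univ_add]
        have e₂ : memSnd (bobMove (memSum B₁ B₂) (aliceMove A φ)) =
            bobMove B₂ (aliceMove A (memSnd φ)) := by
          funext q
          simp [memSnd, bobMove, aliceMove, memSum, Fintype.sum_prod_type, Fin.sum_univ_add]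
        have := ih rest₁ rest₂ (bobMove (memSum B₁ B₂) (aliceMove A φ)) k
        rw [e₁, e₂] at this
        simpa only [CoStrategyFrom.sum, run_cons] using this

/-- There is a co-strategy starting from any given memory space. -/
lemma CoStrategyFrom.exists_of_pos {l : List (ℕ × ℕ)} (hl : ∀ p ∈ l, 0 < p.1) (w : ℕ) :
    ∃ wr, Nonempty (CoStrategyFrom l w wr) := by
  induction l generalizing w with
  | nil => exact ⟨w, ⟨.nil w⟩⟩
  | cons p l ih =>
    obtain ⟨x, y⟩ := p
    have hpos : 0 < firstX l := by
      cases l with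
      | nil => exact Nat.one_pos
      | cons q l => exact hl q (by simp)
    obtain ⟨wr, ⟨rest⟩⟩ := ih (fun q hq => hl q (by simp [hq])) (y * w)
    -- Bob stores everything he receives in memory and sends the fixed basis vector `0`.
    refine ⟨wr, ⟨.cons (Matrix.of fun p q => if p = (⟨0, hpos⟩, finProdFinEquiv q) then 1 else 0)
      ?_ rest⟩⟩
    ext i j
    simp [mul_apply, one_apply, eq_comm]

end DirectSum

/-! ### Gram matrices of final states -/

section RunGram

variable {l : List (ℕ × ℕ)} {zS zT zr : ℕ} (S : StrategyFrom l zS zr) (T : StrategyFrom l zT zr)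

/-- The overlaps `∑_w ψ(z', w)* φ(z, w)` of the final states `ψ`, `φ` of the interactions of `S`
and `T` with the same co-strategy. -/
def runGram {w wr : ℕ} (B : CoStrategyFrom l w wr)
    (φ : Fin (firstX l) × Fin zS × Fin w → ℂ) (φ' : Fin (firstX l) × Fin zT × Fin w → ℂ) :
    Matrix (Fin zr) (Fin zr) ℂ :=
  crossGram (run S B φ) (run T B φ')

lemma runGram_coSum {w₁ wr₁ w₂ wr₂ : ℕ} (B₁ : CoStrategyFrom l w₁ wr₁)
    (B₂ : CoStrategyFrom l w₂ wr₂) (φ : Fin (firstX l) × Fin zS × Fin (w₁ + w₂) → ℂ)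
    (φ' : Fin (firstX l) × Fin zT × Fin (w₁ + w₂) → ℂ) :
    runGram S T (B₁.sum B₂) φ φ' =
      runGram S T B₁ (memFst φ) (memFst φ') + runGram S T B₂ (memSnd φ) (memSnd φ') := by
  ext a b
  simp only [runGram, crossGram, of_apply, Matrix.add_apply, Fin.sum_univ_add,
    (run_coSum S B₁ B₂ φ a).1, (run_coSum S B₁ B₂ φ a).2, (run_coSum T B₁ B₂ φ' b).1,
    (run_coSum T B₁ B₂ φ' b).2]

lemma runGram_zero {w wr : ℕ} (B : CoStrategyFrom l w wr) : runGram S T B 0 0 = 0 := by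
  ext a b
  simp [runGram, run_zero, crossGram]

lemma runGram_smul_smul {w wr : ℕ} (B : CoStrategyFrom l w wr) (c : ℝ)
    (φ : Fin (firstX l) × Fin zS × Fin w → ℂ) (φ' : Fin (firstX l) × Fin zT × Fin w → ℂ) :
    runGram S T B ((c : ℂ) • φ) ((c : ℂ) • φ') = (c ^ 2) • runGram S T B φ φ' := by
  ext a b
  simp only [runGram, run_smul, crossGram, of_apply, Pi.smul_apply, smul_eq_mul, Matrix.smul_apply,
    star_mul', Finset.smul_sum, Complex.real_smul]
  refine Finset.sum_congr rfl fun w _ => ?_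
  rw [← starRingEnd_apply (c : ℂ), Complex.conj_ofReal]
  push_cast
  ring

/-- Sesquilinearity: for given memory dimensions, the rest of the interaction enters only through
finitely many Gram matrices, whatever the size of its final memory. This is the form on which
compactness is proved. -/
lemma runGram_eq_sum {w wr : ℕ} (B : CoStrategyFrom l w wr)
    (φ : Fin (firstX l) × Fin zS × Fin w → ℂ) (φ' : Fin (firstX l) × Fin zT × Fin w → ℂ) :
    runGram S T B φ φ' =
      ∑ p, ∑ q, (star (φ p) * φ' q) • runGram S T B (Pi.single p 1) (Pi.single q 1) := by
  have e : ∀ {k : ℕ} (f : Fin (firstX l) × Fin k × Fin w → ℂ),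
      f = ∑ p, f p • Pi.single p 1 := fun f => by
    funext q; simp [Finset.sum_apply, Pi.single_apply]
  have h1 := run_sum S B φ fun p => Pi.single p 1
  have h2 := run_sum T B φ' fun p => Pi.single p 1
  rw [← e] at h1 h2
  ext a b
  simp only [runGram, crossGram, of_apply, h1, h2, Matrix.sum_apply, Matrix.smul_apply,
    Finset.sum_apply, Pi.smul_apply, smul_eq_mul, star_sum, star_mul', Finset.sum_mul,
    Finset.mul_sum]
  refine (Finset.sum_congr rfl fun _ _ => Finset.sum_comm).trans ?_
  rw [Finset.sum_comm]
  refine Finset.sum_congr rfl fun p _ => ?_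
  rw [Finset.sum_comm]
  exact Finset.sum_congr rfl fun _ _ => Finset.sum_congr rfl fun _ _ => by ring

/-- An operator on the memory applied to a vector in `X ⊗ Z ⊗ W`. -/
def memMove {x z w w' : ℕ} (J : Matrix (Fin w') (Fin w) ℂ) (φ : Fin x × Fin z × Fin w → ℂ) :
    Fin x × Fin z × Fin w' → ℂ :=
  fun q => ∑ a, J q.2.2 a * φ (q.1, q.2.1, a)

/-- The operator `B (I ⊗ J)`. -/
def mulMem {X Y : Type} {w w' : ℕ} (B : Matrix X (Y × Fin w') ℂ) (J : Matrix (Fin w') (Fin w) ℂ) :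
    Matrix X (Y × Fin w) ℂ :=
  Matrix.of fun p q => ∑ a, B p (q.1, a) * J a q.2

lemma mulMem_isometry {X Y : Type} [Fintype X] [DecidableEq Y] {w w' : ℕ}
    {B : Matrix X (Y × Fin w') ℂ} {J : Matrix (Fin w') (Fin w) ℂ} (hB : Bᴴ * B = 1)
    (hJ : Jᴴ * J = 1) : (mulMem B J)ᴴ * mulMem B J = 1 := by
  ext ⟨y, a⟩ ⟨y', a'⟩
  have hB' : ∀ b b', ∑ p, star (B p (y, b)) * B p (y', b') =
      if y = y' ∧ b = b' then 1 else 0 := fun b b' => by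
    have := congrFun (congrFun hB (y, b)) (y', b')
    simpa [mul_apply, one_apply] using this
  have hJ' : ∑ b, star (J b a) * J b a' = if a = a' then 1 else 0 := by
    have := congrFun (congrFun hJ a) a'
    simpa [mul_apply, one_apply] using this
  calc ((mulMem B J)ᴴ * mulMem B J) (y, a) (y', a')
      = ∑ b, ∑ b', (star (J b a) * J b' a') * ∑ p, star (B p (y, b)) * B p (y', b') := by
        simp only [mul_apply, conjTranspose_apply, mulMem, of_apply, star_sum, star_mul',
          Finset.sum_mul, Finset.mul_sum]
        refine (Finset.sum_congr rfl fun _ _ => Finset.sum_comm).trans ?_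
        rw [Finset.sum_comm]
        refine Finset.sum_congr rfl fun p _ => ?_
        rw [Finset.sum_comm]
        exact Finset.sum_congr rfl fun _ _ => Finset.sum_congr rfl fun _ _ => by ring
    _ = if y = y' then ∑ b, star (J b a) * J b a' else 0 := by
        simp only [hB']
        by_cases h : y = y' <;> simp [h]
    _ = _ := by
        rw [hJ']
        by_cases h : y = y' <;> by_cases h' : a = a' <;> simp [h, h', one_apply]

lemma bobMove_aliceMove_memMove {x y x' z z' w d w' : ℕ}
    (A : Matrix (Fin y × Fin z') (Fin x × Fin z) ℂ) (B : Matrix (Fin x' × Fin w') (Fin y × Fin w) ℂ)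
    (J : Matrix (Fin w) (Fin d) ℂ) (φ : Fin x × Fin z × Fin d → ℂ) :
    bobMove B (aliceMove A (memMove J φ)) = bobMove (mulMem B J) (aliceMove A φ) := by
  funext q
  simp only [bobMove, aliceMove, memMove, mulMem, of_apply, Fintype.sum_prod_type]
  refine Finset.sum_congr rfl fun y _ => ?_
  simp_rw [Finset.sum_mul]
  rw [Finset.sum_comm]
  refine Finset.sum_congr rfl fun w _ => ?_
  simp only [Finset.mul_sum]
  conv_rhs => rw [Finset.sum_comm]; enter [2, i]; rw [Finset.sum_comm]
  exact Finset.sum_congr rfl fun _ _ => Finset.sum_congr rfl fun _ _ =>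
    Finset.sum_congr rfl fun _ _ => by ring

/-- An isometry on the initial memory can be absorbed into the co-strategy. -/
lemma exists_runGram_eq_memMove {w d wr : ℕ} (B : CoStrategyFrom l w wr)
    {J : Matrix (Fin w) (Fin d) ℂ} (hJ : Jᴴ * J = 1) :
    ∃ (wr' : ℕ) (B' : CoStrategyFrom l d wr'), ∀ φ φ',
      runGram S T B' φ φ' = runGram S T B (memMove J φ) (memMove J φ') := by
  cases S with
  | nil =>
    cases T; cases B
    -- With no round left the isometry cannot be absorbed into a move; it is dropped, since pairing
    -- over the memory only sees `J*J = 1`.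
    refine ⟨d, .nil d, fun φ φ' => ?_⟩
    ext a b
    have hJ' : ∀ i j, ∑ b, star (J b i) * J b j = if i = j then 1 else 0 := fun i j => by
      have := congrFun (congrFun hJ i) j
      simpa [mul_apply, one_apply] using this
    symm
    calc _ = ∑ i, ∑ j, (star (φ ((0 : Fin 1), a, i)) * φ' ((0 : Fin 1), b, j)) *
          ∑ k, star (J k i) * J k j := by
          simp only [runGram, crossGram, run_nil, of_apply, memMove, star_sum, star_mul',
            Finset.sum_mul, Finset.mul_sum]
          refine (Finset.sum_congr rfl fun _ _ => Finset.sum_comm).trans ?_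
          rw [Finset.sum_comm]
          refine Finset.sum_congr rfl fun p _ => ?_
          rw [Finset.sum_comm]
          exact Finset.sum_congr rfl fun _ _ => Finset.sum_congr rfl fun _ _ => by ring
      _ = _ := by
          simp only [hJ']
          simp [runGram, crossGram, run_nil]
  | cons A hA S =>
    cases T with
    | cons A' hA' T =>
      cases B with
      | cons B hB rest =>
        refine ⟨wr, .cons (mulMem B J) (mulMem_isometry hB hJ) rest, fun φ φ' => ?_⟩
        simp only [runGram, run_cons, bobMove_aliceMove_memMove]

end RunGram

/-! ### Bounding the memory of a co-strategy -/

section BoundedMemory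

/-- A tall matrix factors through an isometry. -/
lemma exists_isometry_mul {n d : ℕ} (hdn : d ≤ n) (M : Matrix (Fin n) (Fin d) ℂ) :
    ∃ (J : Matrix (Fin n) (Fin d) ℂ) (R : Matrix (Fin d) (Fin d) ℂ), Jᴴ * J = 1 ∧ M = J * R := by
  -- The `d` columns of `M`, padded by zeros to `n` vectors, so that Gram–Schmidt gives a full basis
  -- whose first `d` vectors span a space containing the columns.
  let f : Fin n → EuclideanSpace ℂ (Fin n) := fun i =>
    if h : (i : ℕ) < d then WithLp.toLp 2 (fun k => M k ⟨i, h⟩) else 0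
  let b := InnerProductSpace.gramSchmidtOrthonormalBasis (𝕜 := ℂ) (ι := Fin n)
    (E := EuclideanSpace ℂ (Fin n)) (by simp) f
  let J : Matrix (Fin n) (Fin d) ℂ := Matrix.of fun k i => b (Fin.castLE hdn i) k
  refine ⟨J, Matrix.of fun i j => inner ℂ (b (Fin.castLE hdn i)) (f (Fin.castLE hdn j)), ?_, ?_⟩
  · ext i j
    have := (orthonormal_iff_ite.1 b.orthonormal) (Fin.castLE hdn i) (Fin.castLE hdn j)
    rw [PiLp.inner_apply] at this
    simp only [mul_apply, conjTranspose_apply, J, of_apply, one_apply]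
    simp only [RCLike.inner_apply', Fin.castLE_inj] at this
    exact this
  · ext k j
    have hk : M k j = f (Fin.castLE hdn j) k := by simp [f]
    have hsum := b.sum_repr' (f (Fin.castLE hdn j))
    have hz : ∀ i : Fin n, d ≤ (i : ℕ) → inner ℂ (b i) (f (Fin.castLE hdn j)) = 0 := fun i hi =>
      InnerProductSpace.gramSchmidtOrthonormalBasis_inv_triangular _ _
        (by rw [Fin.lt_def]; exact lt_of_lt_of_le j.2 hi)
    have hk' := congrArg (fun v : EuclideanSpace ℂ (Fin n) => v k) hsum
    simp only [WithLp.ofLp_sum, Finset.sum_apply, PiLp.smul_apply, smul_eq_mul] at hk'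
    rw [hk, ← hk', mul_apply]
    symm
    simp only [J, of_apply]
    obtain ⟨e, rfl⟩ := Nat.exists_eq_add_of_le hdn
    rw [Fin.sum_univ_add, Finset.sum_eq_zero (s := Finset.univ (α := Fin e)), add_zero]
    · exact Finset.sum_congr rfl fun i _ => mul_comm _ _
    · intro i _
      rw [hz _ (by simp), zero_mul]

variable {l : List (ℕ × ℕ)} {zS zT zr : ℕ} (S : StrategyFrom l zS zr) (T : StrategyFrom l zT zr)

/-- If the memory is fed from `ℂ^I`, then memory of dimension `dim X * |I|` is enough. -/
lemma exists_boundedMemory (hl : ∀ p ∈ l, 0 < p.1) {I : Type} [Fintype I] {w wr d : ℕ}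
    (e : Fin d ≃ Fin (firstX l) × I) (B : Matrix (Fin (firstX l) × Fin w) I ℂ)
    (rest : CoStrategyFrom l w wr) :
    ∃ (B' : Matrix (Fin (firstX l) × Fin d) I ℂ) (wr' : ℕ) (rest' : CoStrategyFrom l d wr'),
      B'ᴴ * B' = Bᴴ * B ∧ ∀ (η : Fin zS × I → ℂ) (η' : Fin zT × I → ℂ),
        runGram S T rest' (bobMove B' η) (bobMove B' η') =
          runGram S T rest (bobMove B η) (bobMove B η') := by
  obtain ⟨wr₂, ⟨pad⟩⟩ := CoStrategyFrom.exists_of_pos hl d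
  -- Padding the memory by `d` unused dimensions makes the reshaped matrix below tall enough to
  -- factor; `pad` tells Bob what to do on the unused summand.
  let B₂ : Matrix (Fin (firstX l) × Fin (w + d)) I ℂ := Matrix.of fun p i =>
    Fin.addCases (motive := fun _ => ℂ) (fun a => B (p.1, a) i) (fun _ => 0) p.2
  -- The memory index becomes the row and all other indices the column: `R` is the move with memory
  -- `d`, and `J` is handed on to the remaining rounds.
  obtain ⟨J, R, hJ, hM⟩ := exists_isometry_mul (Nat.le_add_left d w)
    (Matrix.of fun a j => B₂ ((e j).1, a) (e j).2)
  obtain ⟨wr', rest', hrest'⟩ := exists_runGram_eq_memMove S T (rest.sum pad) hJ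
  let B' : Matrix (Fin (firstX l) × Fin d) I ℂ := Matrix.of fun p i => R p.2 (e.symm (p.1, i))
  have hB₂ : ∀ x a i, B₂ (x, a) i = ∑ b, J a b * B' (x, b) i := by
    intro x a i
    have := congrFun (congrFun hM a) (e.symm (x, i))
    simpa only [of_apply, mul_apply, Equiv.apply_symm_apply, B'] using this
  have hmove : ∀ {z : ℕ} (η : Fin z × I → ℂ), memMove J (bobMove B' η) = bobMove B₂ η := by
    intro z η
    funext q
    simp only [memMove, bobMove, hB₂, Finset.mul_sum, Finset.sum_mul]
    rw [Finset.sum_comm]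
    exact Finset.sum_congr rfl fun _ _ => Finset.sum_congr rfl fun _ _ => by ring
  have hfst : ∀ {z : ℕ} (η : Fin z × I → ℂ), memFst (bobMove B₂ η) = bobMove B η := by
    intro z η
    funext q
    simp [memFst, bobMove, B₂]
  have hsnd : ∀ {z : ℕ} (η : Fin z × I → ℂ), memSnd (bobMove B₂ η) = 0 := by
    intro z η
    funext q
    simp [memSnd, bobMove, B₂]
  refine ⟨B', wr', rest', ?_, fun η η' => ?_⟩
  · have hJ' : ∀ i j, ∑ b, star (J b i) * J b j = if i = j then 1 else 0 := fun i j => by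
      have := congrFun (congrFun hJ i) j
      simpa [mul_apply, one_apply] using this
    ext i j
    have h1 : (Bᴴ * B) i j = ∑ x, ∑ a, star (B₂ (x, a) i) * B₂ (x, a) j := by
      simp [mul_apply, Fintype.sum_prod_type, Fin.sum_univ_add, B₂]
    rw [h1]
    simp only [mul_apply, conjTranspose_apply, Fintype.sum_prod_type]
    refine Finset.sum_congr rfl fun x _ => ?_
    symm
    calc _ = ∑ b, ∑ c, (star (B' (x, b) i) * B' (x, c) j) * ∑ a, star (J a b) * J a c := by
          simp only [hB₂, star_sum, star_mul', Finset.sum_mul, Finset.mul_sum]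
          refine (Finset.sum_congr rfl fun _ _ => Finset.sum_comm).trans ?_
          rw [Finset.sum_comm]
          refine Finset.sum_congr rfl fun p _ => ?_
          rw [Finset.sum_comm]
          exact Finset.sum_congr rfl fun _ _ => Finset.sum_congr rfl fun _ _ => by ring
      _ = _ := by
          simp only [hJ']
          simp
  · rw [hrest', hmove, hmove, runGram_coSum, hfst, hfst, hsnd, hsnd, runGram_zero, add_zero]

end BoundedMemory

/-! ### Compactness -/

section Compactness

lemma isCompact_isometries (m n : Type) [Fintype m] [Fintype n] [DecidableEq m] [DecidableEq n] :
    IsCompact {B : Matrix m n ℂ | Bᴴ * B = 1} := by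
  have hK : IsCompact (Set.pi Set.univ fun _ : m => Set.pi Set.univ fun _ : n =>
      Metric.closedBall (0 : ℂ) 1) :=
    isCompact_univ_pi fun _ => isCompact_univ_pi fun _ => isCompact_closedBall _ _
  refine IsCompact.of_isClosed_subset (s := (Set.pi Set.univ fun _ : m => Set.pi Set.univ
    fun _ : n => Metric.closedBall (0 : ℂ) 1 : Set (Matrix m n ℂ))) hK ?_ ?_
  · exact isClosed_eq (by fun_prop) continuous_const
  · intro B hB i _ j _
    simpa using norm_apply_le_one (le_of_eq hB) i j

/-- The Gram matrices of final states, for all pairs of basis vectors as initial states, over all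
co-strategies with initial memory `ℂ^w`. -/
def kernelSet {l : List (ℕ × ℕ)} {zS zT zr : ℕ} (S : StrategyFrom l zS zr)
    (T : StrategyFrom l zT zr) (w : ℕ) :
    Set ((Fin (firstX l) × Fin zS × Fin w) → (Fin (firstX l) × Fin zT × Fin w) →
      Matrix (Fin zr) (Fin zr) ℂ) :=
  {κ | ∃ (wr : ℕ) (B : CoStrategyFrom l w wr),
    κ = fun p q => runGram S T B (Pi.single p 1) (Pi.single q 1)}

lemma continuous_bobMove {x z w : ℕ} {I : Type} [Fintype I] (η : Fin z × I → ℂ)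
    (p : Fin x × Fin z × Fin w) :
    Continuous fun B : Matrix (Fin x × Fin w) I ℂ => bobMove B η p := by
  unfold bobMove
  fun_prop

/-- Induction on the rounds. The first move may be taken with memory of fixed dimension `d`, so it
ranges over a compact set of isometries. The remaining rounds range over a compact kernel set by
induction, and the whole is a continuous image of the product. -/
lemma isCompact_kernelSet {l : List (ℕ × ℕ)} (hl : ∀ p ∈ l, 0 < p.1) {zS zT zr : ℕ}
    (S : StrategyFrom l zS zr) (T : StrategyFrom l zT zr) (w : ℕ) :
    IsCompact (kernelSet S T w) := by
  induction S generalizing zT w with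
  | nil zS =>
    cases T
    have : kernelSet (.nil zS) (.nil zS) w =
        {fun p q => runGram (.nil zS) (.nil zS) (.nil w) (Pi.single p 1) (Pi.single q 1)} := by
      ext κ
      constructor
      · rintro ⟨wr, B, rfl⟩
        cases B
        rfl
      · rintro rfl
        exact ⟨w, .nil w, rfl⟩
    rw [this]
    exact isCompact_singleton
  | @cons x y l zS zS' zr A hA S ih =>
    cases T with
    | cons A' hA' T =>
      have hl' : ∀ p ∈ l, 0 < p.1 := fun p hp => hl p (by simp [hp])
      let d := Fintype.card (Fin (firstX l) × (Fin y × Fin w))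
      let e : Fin d ≃ Fin (firstX l) × (Fin y × Fin w) := (Fintype.equivFin _).symm
      have hK := (isCompact_isometries (Fin (firstX l) × Fin d) (Fin y × Fin w)).prod
        (ih hl' T d)
      let F : Matrix (Fin (firstX l) × Fin d) (Fin y × Fin w) ℂ ×
          ((Fin (firstX l) × Fin _ × Fin d) → (Fin (firstX l) × Fin _ × Fin d) →
            Matrix (Fin zr) (Fin zr) ℂ) →
          (Fin x × Fin zS × Fin w) → (Fin x × Fin zT × Fin w) → Matrix (Fin zr) (Fin zr) ℂ :=
        fun P p q => ∑ p', ∑ q', (star (bobMove P.1 (aliceMove A (Pi.single p 1)) p') *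
          bobMove P.1 (aliceMove A' (Pi.single q 1)) q') • P.2 p' q'
      have hF : Continuous F := by
        refine continuous_pi fun p => continuous_pi fun q => continuous_finsetSum _ fun p' _ =>
          continuous_finsetSum _ fun q' _ => Continuous.fun_smul (Continuous.fun_mul ?_ ?_) ?_
        · exact ((continuous_bobMove _ p').comp continuous_fst).star
        · exact (continuous_bobMove _ q').comp continuous_fst
        · exact (continuous_apply_apply p' q').comp continuous_snd
      convert hK.image hF using 1
      ext κ
      constructor
      · rintro ⟨wr, B, rfl⟩
        cases B with
        | cons B hB rest =>
          -- Only this inclusion needs the memory bound: the given first move may use memory of any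
          -- size.
          obtain ⟨B', wr', rest', h1, h2⟩ := exists_boundedMemory S T hl' e B rest
          refine ⟨(B', _), ⟨h1.trans hB, wr', rest', rfl⟩, ?_⟩
          funext p q
          simp only [runGram, run_cons]
          exact (runGram_eq_sum S T rest' _ _).symm.trans (h2 _ _)
      · rintro ⟨⟨B, κ⟩, ⟨hB, wr, rest, rfl⟩, rfl⟩
        refine ⟨wr, .cons B hB rest, ?_⟩
        funext p q
        simp only [runGram, run_cons]
        exact (runGram_eq_sum S T rest _ _).symm

end Compactness

/-! ### The set of Gram matrices of a pair of strategies -/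

section GramSet

variable {l : List (ℕ × ℕ)} {zr : ℕ} (S T : PureStrategy l zr)

/-- The Gram matrices of the final states of `S` and `T`, over all pure co-strategies. -/
def gramSet : Set (Matrix (Fin zr) (Fin zr) ℂ) :=
  {C | ∃ (wr : ℕ) (B : PureCoStrategy l wr), C = crossGram (finalState S B) (finalState T B)}

lemma conjTranspose_mul_self_col_eq_one_iff {m : Type} [Fintype m] (β : Matrix m Unit ℂ) :
    βᴴ * β = 1 ↔ ∑ p, ‖β p ()‖ ^ 2 = 1 := by
  have h : (βᴴ * β) () () = ((∑ p, ‖β p ()‖ ^ 2 : ℝ) : ℂ) := by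
    simp [mul_apply, Complex.conj_mul']
  constructor
  · intro h1
    rw [h1, one_apply_eq] at h
    exact_mod_cast h.symm
  · intro h1
    ext ⟨⟩ ⟨⟩
    rw [h, h1]
    simp

lemma finalState_eq_bobMove {wr : ℕ} (A : PureStrategy l zr) (B : PureCoStrategy l wr) :
    finalState A B =
      run A B.maps (bobMove (Matrix.of fun p (_ : Unit) => B.init p) fun _ => 1) := by
  rw [finalState]
  congr 1
  funext q
  simp [bobMove]

/-- The initial state is an isometry from a one-dimensional space, so the argument for
`isCompact_kernelSet` applies once more with `Unit` as the incoming space. -/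
lemma isCompact_gramSet (hl : ∀ p ∈ l, 0 < p.1) : IsCompact (gramSet S T) := by
  let d := Fintype.card (Fin (firstX l) × Unit)
  let e : Fin d ≃ Fin (firstX l) × Unit := (Fintype.equivFin _).symm
  have hK := (isCompact_isometries (Fin (firstX l) × Fin d) Unit).prod (isCompact_kernelSet hl S T d)
  let F : Matrix (Fin (firstX l) × Fin d) Unit ℂ ×
      ((Fin (firstX l) × Fin 1 × Fin d) → (Fin (firstX l) × Fin 1 × Fin d) →
        Matrix (Fin zr) (Fin zr) ℂ) → Matrix (Fin zr) (Fin zr) ℂ :=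
    fun P => ∑ p, ∑ q, (star (bobMove P.1 (fun _ => 1) p) * bobMove P.1 (fun _ => 1) q) • P.2 p q
  have hF : Continuous F := by
    refine continuous_finsetSum _ fun p _ =>
      continuous_finsetSum _ fun q _ => Continuous.fun_smul (Continuous.fun_mul ?_ ?_) ?_
    · exact ((continuous_bobMove (fun _ => 1) p).comp continuous_fst).star
    · exact (continuous_bobMove (fun _ => 1) q).comp continuous_fst
    · exact (continuous_apply_apply p q).comp continuous_snd
  convert hK.image hF using 1
  ext C
  constructor
  · rintro ⟨wr, B, rfl⟩
    obtain ⟨B', wr', rest', h1, h2⟩ :=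
      exists_boundedMemory S T hl e (Matrix.of fun p (_ : Unit) => B.init p) B.maps
    refine ⟨(B', _), ⟨h1.trans ?_, wr', rest', rfl⟩, ?_⟩
    · rw [conjTranspose_mul_self_col_eq_one_iff]
      exact B.init_unit
    · rw [finalState_eq_bobMove, finalState_eq_bobMove]
      exact (runGram_eq_sum S T rest' _ _).symm.trans (h2 _ _)
  · rintro ⟨⟨β, κ⟩, ⟨hβ, wr, rest, rfl⟩, rfl⟩
    refine ⟨wr, ⟨d, fun p => β p (), (conjTranspose_mul_self_col_eq_one_iff β).1 hβ, rest⟩, ?_⟩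
    rw [finalState_eq_bobMove, finalState_eq_bobMove]
    exact (runGram_eq_sum S T rest _ _).symm

/-- Bob's memory coherently carries which of two co-strategies is played. The blocks are orthogonal,
so the Gram matrices add with the squared amplitudes `a` and `b`. -/
lemma convex_gramSet : Convex ℝ (gramSet S T) := by
  rintro _ ⟨wr₁, B₁, rfl⟩ _ ⟨wr₂, B₂, rfl⟩ a b ha hb hab
  let β : Fin (firstX l) × Fin (B₁.w₀ + B₂.w₀) → ℂ := fun p =>
    Fin.addCases (motive := fun _ => ℂ) (fun w => (Real.sqrt a : ℂ) * B₁.init (p.1, w))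
      (fun w => (Real.sqrt b : ℂ) * B₂.init (p.1, w)) p.2
  have hβ : ∑ p, ‖β p‖ ^ 2 = 1 := by
    have h₁ := B₁.init_unit
    have h₂ := B₂.init_unit
    rw [Fintype.sum_prod_type] at h₁ h₂ ⊢
    simp only [Fin.sum_univ_add, β, Fin.addCases_left, Fin.addCases_right, norm_mul, mul_pow,
      Finset.sum_add_distrib, ← Finset.mul_sum, h₁, h₂, Complex.norm_real, Real.norm_eq_abs, sq_abs,
      Real.sq_sqrt ha, Real.sq_sqrt hb]
    linarith
  refine ⟨wr₁ + wr₂, ⟨_, β, hβ, B₁.maps.sum B₂.maps⟩, ?_⟩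
  have h := runGram_coSum S T B₁.maps B₂.maps (fun q => β (q.1, q.2.2)) (fun q => β (q.1, q.2.2))
  have e₁ : memFst (z := 1) (fun q : Fin (firstX l) × Fin 1 × Fin (B₁.w₀ + B₂.w₀) =>
      β (q.1, q.2.2)) = (Real.sqrt a : ℂ) • fun q => B₁.init (q.1, q.2.2) := by
    funext q
    simp [memFst, β]
  have e₂ : memSnd (z := 1) (fun q : Fin (firstX l) × Fin 1 × Fin (B₁.w₀ + B₂.w₀) =>
      β (q.1, q.2.2)) = (Real.sqrt b : ℂ) • fun q => B₂.init (q.1, q.2.2) := by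
    funext q
    simp [memSnd, β]
  rw [e₁, e₂, runGram_smul_smul, runGram_smul_smul, Real.sq_sqrt ha, Real.sq_sqrt hb] at h
  exact h.symm

lemma gramSet_nonempty (hl : ∀ p ∈ l, 0 < p.1) : (gramSet S T).Nonempty := by
  obtain ⟨wr, ⟨B⟩⟩ := CoStrategyFrom.exists_of_pos hl 1
  have hpos : 0 < firstX l := by
    cases l with
    | nil => exact Nat.one_pos
    | cons q l => exact hl q (by simp)
  refine ⟨_, wr, ⟨1, Pi.single (⟨0, hpos⟩, 0) 1, ?_, B⟩, rfl⟩
  rw [Finset.sum_eq_single (⟨0, hpos⟩, 0)]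
  · simp
  · intro p _ hp
    simp [Pi.single_eq_of_ne hp]
  · simp

end GramSet

/-! ### The reduced final state depends only on the strategy -/

section ReducedState

lemma sum_XIdx_cons {x y : ℕ} {l : List (ℕ × ℕ)} (f : Fin x → XIdx l → ℂ) :
    ∑ p : XIdx ((x, y) :: l), f p.head p.tail = ∑ a, ∑ s, f a s :=
  Fintype.sum_prod_type (fun p : Fin x × XIdx l => f p.1 p.2)

lemma sum_YIdx_cons {x y : ℕ} {l : List (ℕ × ℕ)} (f : Fin y → YIdx l → ℂ) :
    ∑ p : YIdx ((x, y) :: l), f p.head p.tail = ∑ a, ∑ s, f a s :=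
  Fintype.sum_prod_type (fun p : Fin y × YIdx l => f p.1 p.2)

lemma CoStrategyFrom.op_sum {l : List (ℕ × ℕ)} {w wr : ℕ} (B : CoStrategyFrom l w wr)
    {ι : Type} [Fintype ι] (c : ι → ℂ) (β : ι → Fin (firstX l) × Fin w → ℂ)
    (p : XIdx l × Fin wr) (y : YIdx l) :
    B.op (fun q => ∑ i, c i * β i q) p y = ∑ i, c i * B.op (β i) p y := by
  induction B with
  | nil w => simp [CoStrategyFrom.op]
  | cons B hB rest ih =>
    simp only [CoStrategyFrom.op, of_apply]
    rw [← ih]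
    congr 2
    funext q
    simp only [Finset.mul_sum]
    rw [Finset.sum_comm]
    exact Finset.sum_congr rfl fun _ _ => Finset.sum_congr rfl fun _ _ => by ring

/-- Links the round-by-round interaction to the composed operators, in terms of which Choi operators
are defined. -/
lemma run_eq_sum_op {l : List (ℕ × ℕ)} {z zr w wr : ℕ} (A : StrategyFrom l z zr)
    (B : CoStrategyFrom l w wr) (φ : Fin (firstX l) × Fin z × Fin w → ℂ) (k : Fin zr)
    (m : Fin wr) :
    run A B φ (k, m) = ∑ x, ∑ y, ∑ j, A.op (y, k) (x, j) *
      B.op (fun q => φ (q.1, j, q.2)) (x, m) y := by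
  induction A generalizing w with
  | nil z =>
    cases B
    simp only [StrategyFrom.op, CoStrategyFrom.op, of_apply, run_nil, ite_mul, one_mul, zero_mul,
      Finset.sum_ite_eq, Finset.mem_univ, if_true, Finset.sum_const]
    have h1 : (Finset.univ : Finset (XIdx [])).card = 1 := rfl
    have h2 : (Finset.univ : Finset (YIdx [])).card = 1 := rfl
    rw [h1, h2, one_smul, one_smul]
  | @cons x y l z z' zr A hA restA ih =>
    cases B with
    | cons B hB restB =>
      rw [run_cons, ih]
      simp only [StrategyFrom.op, CoStrategyFrom.op, of_apply]
      have hmove : ∀ j, (fun q : Fin (firstX l) × Fin _ => bobMove B (aliceMove A φ) (q.1, j, q.2)) =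
          fun q => ∑ i : Fin y × Fin x × Fin z, A (i.1, j) (i.2.1, i.2.2) *
            ∑ v, B q (i.1, v) * φ (i.2.1, i.2.2, v) := by
        intro j
        funext q
        simp only [bobMove, aliceMove, Fintype.sum_prod_type, Finset.mul_sum]
        refine Finset.sum_congr rfl fun _ _ => ?_
        rw [Finset.sum_comm]
        refine Finset.sum_congr rfl fun _ _ => ?_
        rw [Finset.sum_comm]
        exact Finset.sum_congr rfl fun _ _ => Finset.sum_congr rfl fun _ _ => by ring
      simp only [hmove, CoStrategyFrom.op_sum]
      let o : Fin x → Fin y → Fin z → XIdx l → YIdx l → ℂ := fun a b j s t =>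
        restB.op (fun q => ∑ v, B q (b, v) * φ (a, j, v)) (s, m) t
      let G : Fin x → Fin y → XIdx l → YIdx l → ℂ := fun a b s t =>
        ∑ j, (∑ i, restA.op (t, k) (s, i) * A (b, i) (a, j)) * o a b j s t
      have hG : ∀ s t, ∑ i, restA.op (t, k) (s, i) * ∑ c : Fin y × Fin x × Fin z,
          A (c.1, i) (c.2.1, c.2.2) * o c.2.1 c.1 c.2.2 s t = ∑ a, ∑ b, G a b s t := by
        intro s t
        simp only [Finset.mul_sum]
        rw [Finset.sum_comm, Fintype.sum_prod_type, Finset.sum_comm (s := Finset.univ (α := Fin x))]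
        refine Finset.sum_congr rfl fun b _ => ?_
        rw [Fintype.sum_prod_type]
        refine Finset.sum_congr rfl fun a _ => Finset.sum_congr rfl fun j _ => ?_
        rw [Finset.sum_mul]
        exact Finset.sum_congr rfl fun i _ => (mul_assoc _ _ _).symm
      calc _ = ∑ s, ∑ t, ∑ a, ∑ b, G a b s t :=
            Finset.sum_congr rfl fun s _ => Finset.sum_congr rfl fun t _ => hG s t
        _ = ∑ a, ∑ s, ∑ b, ∑ t, G a b s t := by
            rw [Finset.sum_comm (s := Finset.univ (α := Fin x))]
            refine Finset.sum_congr rfl fun s _ => ?_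
            rw [Finset.sum_comm]
            exact Finset.sum_congr rfl fun a _ => Finset.sum_comm
        _ = ∑ a, ∑ s, ∑ q : YIdx ((x, y) :: l), G a q.head s q.tail :=
            Finset.sum_congr rfl fun a _ => Finset.sum_congr rfl fun s _ =>
              (sum_YIdx_cons (G a · s ·)).symm
        _ = _ := (sum_XIdx_cons fun a s => ∑ q : YIdx ((x, y) :: l), G a q.head s q.tail).symm

/-- The final state in terms of the two isometries. -/
lemma finalState_eq_sum {l : List (ℕ × ℕ)} {zr wr : ℕ} (A : PureStrategy l zr)
    (B : PureCoStrategy l wr) (k : Fin zr) (m : Fin wr) :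
    finalState A B (k, m) = ∑ p : YIdx l × XIdx l,
      PureStrategy.iso A (p.1, k) p.2 * PureCoStrategy.iso B (p.2, m) p.1 := by
  rw [finalState, run_eq_sum_op, Fintype.sum_prod_type, Finset.sum_comm]
  simp [PureStrategy.iso, PureCoStrategy.iso]

lemma choi_stinespring_apply {I O M : Type} [Fintype I] [Fintype O] [Fintype M] [DecidableEq I]
    (V : Matrix (O × M) I ℂ) (p q : O × I) :
    choi (stinespring V) p q = ∑ m, V (p.1, m) p.2 * star (V (q.1, m) q.2) := by
  simp [choi, stinespring, ptraceSnd, mul_apply, single_apply, ite_and]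

/-- Summing over Alice's final memory turns two copies of her isometry into an entry of her Choi
operator, so the reduced state does not depend on the purification. -/
lemma ptraceFst_ketbra_finalState {l : List (ℕ × ℕ)} {zr wr : ℕ} (A : PureStrategy l zr)
    (B : PureCoStrategy l wr) (m m' : Fin wr) :
    ptraceFst (ketbra (finalState A B)) m m' = ∑ p, ∑ q, PureStrategy.toOp A p q *
      (PureCoStrategy.iso B (p.2, m) p.1 * star (PureCoStrategy.iso B (q.2, m') q.1)) := by
  simp only [ptraceFst, ketbra, of_apply, vecMulVec_apply, Pi.star_apply, finalState_eq_sum,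
    PureStrategy.toOp, choi_stinespring_apply, star_sum, star_mul', Finset.sum_mul, Finset.mul_sum]
  refine (Finset.sum_congr rfl fun _ _ => Finset.sum_comm).trans ?_
  rw [Finset.sum_comm]
  refine Finset.sum_congr rfl fun p _ => ?_
  rw [Finset.sum_comm]
  exact Finset.sum_congr rfl fun _ _ => Finset.sum_congr rfl fun _ _ => by ring

lemma Strategy.IsPurification.finalMix_eq {l : List (ℕ × ℕ)} {S : Strategy l} {zr wr : ℕ}
    {A : PureStrategy l zr} (hA : S.IsPurification A) (B : PureCoStrategy l wr) :
    finalMix S B = ptraceFst (ketbra (finalState A B)) := by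
  ext m m'
  rw [finalMix, ptraceFst_ketbra_finalState, ptraceFst_ketbra_finalState,
    S.exists_pure.choose_spec.choose_spec, hA]

/-- Reshaping a vector into a matrix `V` from `Z` to `W` makes its reduced state `VV*`, so
`fidelity_mul_conjTranspose` applies. -/
lemma fidelity_ptraceFst_ketbra {Z W : Type} [Fintype Z] [Fintype W] [DecidableEq Z]
    [DecidableEq W] (ψ φ : Z × W → ℂ) :
    fidelity (ptraceFst (ketbra ψ)) (ptraceFst (ketbra φ)) = nuclearNorm (crossGram ψ φ) := by
  have h : ∀ χ : Z × W → ℂ, ptraceFst (ketbra χ) =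
      (Matrix.of fun w z => χ (z, w) : Matrix W Z ℂ) * (Matrix.of fun w z => χ (z, w))ᴴ := by
    intro χ
    ext w w'
    simp [ptraceFst, ketbra, mul_apply, vecMulVec_apply]
  rw [h, h, fidelity_mul_conjTranspose]
  congr 1

end ReducedState

/-! ### Values of the two optimization problems -/

section Values

variable {l : List (ℕ × ℕ)} {zr : ℕ}

lemma fidelityValues_eq_image {S T : Strategy l} {St Tt : PureStrategy l zr}
    (hS : S.IsPurification St) (hT : T.IsPurification Tt) :
    fidelityValues S T = nuclearNorm '' gramSet St Tt := by
  ext v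
  constructor
  · rintro ⟨_, wr, Bt, -, rfl⟩
    refine ⟨_, ⟨wr, Bt, rfl⟩, ?_⟩
    rw [hS.finalMix_eq, hT.finalMix_eq, fidelity_ptraceFst_ketbra]
  · rintro ⟨_, ⟨wr, Bt, rfl⟩, rfl⟩
    refine ⟨⟨Bt.toOp, wr, Bt, rfl⟩, wr, Bt, rfl, ?_⟩
    rw [hS.finalMix_eq, hT.finalMix_eq, fidelity_ptraceFst_ketbra]

lemma overlapValues_krausMap {ι : Type} [Fintype ι] [DecidableEq ι]
    (K : ι → Matrix (Fin zr) (Fin zr) ℂ) (St Tt : PureStrategy l zr) :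
    overlapValues (krausMap K) St Tt =
      (fun C => ∑ k, ‖((K k)ᵀ * C).trace‖ ^ 2) '' gramSet St Tt := by
  ext v
  constructor
  · rintro ⟨wr, B, rfl⟩
    refine ⟨_, ⟨wr, B, rfl⟩, ?_⟩
    rw [overlap, star_dotProduct_tensorId_krausMap, Complex.ofReal_re]
  · rintro ⟨_, ⟨wr, B, rfl⟩, rfl⟩
    refine ⟨wr, B, ?_⟩
    rw [overlap, star_dotProduct_tensorId_krausMap, Complex.ofReal_re]

lemma _root_.IsCompact.exists_isLeast_image {α : Type} [TopologicalSpace α] {s : Set α}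
    (hs : IsCompact s) (hne : s.Nonempty) {f : α → ℝ} (hf : Continuous f) :
    ∃ m, IsLeast (f '' s) m :=
  (hs.image hf).exists_isLeast (hne.image f)

/-- The strategy generalization of Uhlmann's theorem for an arbitrary list of message spaces whose
input spaces are nonzero. -/
theorem isGreatest_strategyFidelity_sq (hl : ∀ p ∈ l, 0 < p.1) {S T : Strategy l}
    {St Tt : PureStrategy l zr} (hS : S.IsPurification St) (hT : T.IsPurification Tt) :
    IsLeast (fidelityValues S T) (strategyFidelity S T) ∧
    (∀ Ξ : Matrix (Fin zr) (Fin zr) ℂ →ₗ[ℂ] Matrix (Fin zr) (Fin zr) ℂ, IsChannel Ξ →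
      ∃ m : ℝ, IsLeast (overlapValues Ξ St Tt) m) ∧
    IsGreatest
      {m : ℝ | ∃ Ξ : Matrix (Fin zr) (Fin zr) ℂ →ₗ[ℂ] Matrix (Fin zr) (Fin zr) ℂ,
        IsChannel Ξ ∧ IsLeast (overlapValues Ξ St Tt) m}
      (strategyFidelity S T ^ 2) := by
  have hcomp := isCompact_gramSet St Tt hl
  have hne := gramSet_nonempty St Tt hl
  have hmin : IsLeast (fidelityValues S T) (strategyFidelity S T) := by
    obtain ⟨m, hm⟩ := hcomp.exists_isLeast_image hne continuous_nuclearNorm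
    rw [← fidelityValues_eq_image hS hT] at hm
    rw [strategyFidelity, hm.csInf_eq]
    exact hm
  have hmin' := hmin
  rw [fidelityValues_eq_image hS hT] at hmin'
  obtain ⟨⟨C₀, hC₀, hm⟩, hlow⟩ := hmin'
  refine ⟨hmin, fun Ξ hΞ => ?_, ?_, ?_⟩
  · obtain ⟨K, rfl, -⟩ := hΞ.exists_kraus
    rw [overlapValues_krausMap]
    exact hcomp.exists_isLeast_image hne (by fun_prop)
  · have hle : ∀ C ∈ gramSet St Tt, strategyFidelity S T ≤ nuclearNorm C :=
      fun C hC => hlow ⟨C, hC, rfl⟩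
    have h0 : 0 ≤ strategyFidelity S T := hm ▸ nuclearNorm_nonneg C₀
    obtain ⟨K, hK, hKC⟩ : ∃ K : Matrix (Fin zr) (Fin zr) ℂ, Kᴴ * K ≤ 1 ∧
        ∀ C ∈ gramSet St Tt, strategyFidelity S T ≤ (K * C).trace.re := by
      rcases h0.eq_or_lt with h | h
      -- At value zero the ball is empty and gives nothing to separate from, but the zero
      -- contraction already suffices.
      · exact ⟨0, by simp, fun C _ => by simp [← h]⟩
      · exact exists_contraction_of_forall_le_nuclearNorm (convex_gramSet St Tt) h hle
    -- The overlap pairs `C` with transposed Kraus operators, so `Kᵀ` is the one to complete to a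
    -- channel.
    obtain ⟨L, hL, hLK⟩ := exists_channel_of_contraction (transpose_contraction hK)
    refine ⟨krausMap L, isChannel_krausMap hL, ?_⟩
    rw [overlapValues_krausMap]
    have hge : ∀ C ∈ gramSet St Tt,
        strategyFidelity S T ^ 2 ≤ ∑ k, ‖((L k)ᵀ * C).trace‖ ^ 2 := by
      intro C hC
      refine le_trans ?_ (Finset.single_le_sum (f := fun k => ‖((L k)ᵀ * C).trace‖ ^ 2)
        (fun _ _ => by positivity) (Finset.mem_univ true))
      simp only [hLK, transpose_transpose]
      exact pow_le_pow_left₀ h0 ((hKC C hC).trans (Complex.re_le_norm _)) 2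
    -- The minimizer of the trace norm also minimizes the overlap for this channel, where the
    -- general upper bound meets the lower one.
    refine ⟨⟨C₀, hC₀, le_antisymm ?_ (hge C₀ hC₀)⟩, ?_⟩
    · rw [← hm]
      exact sum_norm_trace_sq_le hL C₀
    · rintro _ ⟨C, hC, rfl⟩
      exact hge C hC
  · rintro m ⟨Ξ, hΞ, hleast⟩
    obtain ⟨K, rfl, hK⟩ := hΞ.exists_kraus
    rw [overlapValues_krausMap] at hleast
    rw [← hm]
    exact (hleast.2 ⟨C₀, hC₀, rfl⟩).trans (sum_norm_trace_sq_le hK C₀)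

end Values

end QStrat

end

/-- The strategy generalization of Uhlmann's theorem: all the minima exist, and
`F_r(S, T)² = max_Ξ min_B ⟨ψ(S, B)| (Ξ ⊗ I)(|ψ(T, B)⟩⟨ψ(T, B)|) |ψ(S, B)⟩`. -/
theorem mainTheorem1 {r : ℕ} (hr : 1 ≤ r) (X Y : Fin r → ℕ)
    (hX : ∀ i, 0 < X i) (hY : ∀ i, 0 < Y i)
    (S T : QStrat.Strategy (QStrat.rounds X Y)) {zr : ℕ}
    (St Tt : QStrat.PureStrategy (QStrat.rounds X Y) zr)
    (hS : S.IsPurification St) (hT : T.IsPurification Tt) :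
    IsLeast (QStrat.fidelityValues S T) (QStrat.strategyFidelity S T) ∧
    (∀ Ξ : Matrix (Fin zr) (Fin zr) ℂ →ₗ[ℂ] Matrix (Fin zr) (Fin zr) ℂ, QStrat.IsChannel Ξ →
      ∃ m : ℝ, IsLeast (QStrat.overlapValues Ξ St Tt) m) ∧
    IsGreatest
      {m : ℝ | ∃ Ξ : Matrix (Fin zr) (Fin zr) ℂ →ₗ[ℂ] Matrix (Fin zr) (Fin zr) ℂ,
        QStrat.IsChannel Ξ ∧ IsLeast (QStrat.overlapValues Ξ St Tt) m}
      (QStrat.strategyFidelity S T ^ 2) := by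
  refine QStrat.isGreatest_strategyFidelity_sq (fun p hp => ?_) hS hT
  obtain ⟨i, rfl⟩ := (List.mem_ofFn' _ _).1 hp
  exact hX i
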